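/- **Model.** A network is a finite connected simple graph $G=(V,E)$ with maximal degree $\Delta$ and diameter $D$; $N_p$ is the set of neighbours of $p$. We use the local shared memory model: a processor writes its own variables and reads its own and those of its neighbours. In every step a distributed daemon selects a nonempty set of enabled processors (if there is one), which execute enabled actions simultaneously. The daemon is weakly fair: a continuously enabled processor is eventually selected. The initial configuration is arbitrary. A processor is neutralized in a step if it was enabled, executes nothing and is not enabled afterwards. The first round of an execution is its minimal nonempty prefix in which every initially enabled processor executes an action or is neutralized; the following rounds are defined in the same way on the remaining suffix. Rounds counted from a configuration are the rounds of the execution suffix that starts there. **Routing.** $\mathcal A$ is an algorithm of this model such that the local state of $p$ determines, for every $d\in V$, an entry $nextHop_p(d)$, which lies in $N_p$ if $p\ne d$. $\mathcal A$ is self-stabilizing and silent with stabilization time (at most) $R_{\mathcal A}$ rounds: from any configuration, every execution of $\mathcal A$ under a distributed weakly fair daemon is, after $R_{\mathcal A}$ rounds, in a configuration in which no action of $\mathcal A$ is enabled and the tables induce shortest paths, i.e. $dist(nextHop_p(d),d)=dist(p,d)-1$ for all $p\neq d$. **The protocol $\mathcal{SSMFP}_1$.** For every destination $d$, processor $p$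 has two buffers $bufR_p(d)$, $bufE_p(d)$, each empty ($\varepsilon$) or holding a triple $(m,q,c)$: useful information $m$, last processor crossed $q\in N_p\cup\{p\}$, colour $c\in\{0,\dots,\Delta\}$. It also has a bit $request_p$; when this is true, a message $nextMessage_p$ of destination $nextDestination_p$ is waiting. The higher layer may set $request_p$ to true, with any waiting message, whenever it is false; while it is true, the waiting message does not change. The candidates for $bufR_p(d)$ are the $s\in N_p$ with $bufE_s(d)\neq\varepsilon$ and $nextHop_s(d)=p$, together with $p$ itself if $request_p$ is true and $nextDestination_p=d$. A FIFO queue contains exactly the candidates, without repetition (in arbitrary order initially): a processor whose message enters $bufR_p(d)$ leaves its place, processors that are no longer candidates are removed, and the missing candidates (including the processor just served, if it still is one) are added at the end. $choice_p(d)$ is the head of the queue. $color_p(d)$ is any colour that is not carried by a message in $bufR_s(d)$ for any $s\in N_p$. The rules of $p$ for $d$ are the following, where a prime or a dot denotes an arbitrary value. - $(R_1)$ If $request_p$, $nextDestination_p=d$, $bufR_p(d)=\varepsilon$ and $choice_p(d)=p$: $bufR_p(d):=(nextMessage_p,p,0)$; $request_p:=false$. - $(R_2)$ If $bufE_p(d)=\varepsilon$,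 $bufR_p(d)=(m,q,c)$ and ($q=p$ or $bufE_q(d)$ is not of the form $(m,\cdot,c)$): $bufE_p(d):=(m,p,color_p(d))$; $bufR_p(d):=\varepsilon$. - $(R_3)$ If $bufR_p(d)=\varepsilon$, $choice_p(d)=s\neq p$ and $bufE_s(d)=(m,q,c)$: $bufR_p(d):=(m,s,c)$. - $(R_4)$ If $p\ne d$, $bufE_p(d)=(m,q,c)$, $bufR_{nextHop_p(d)}(d)=(m,p,c)$ and $bufR_r(d)\neq(m,p,c)$ for all $r\in N_p\setminus\{nextHop_p(d)\}$: $bufE_p(d):=\varepsilon$. - $(R_5)$ If $bufR_p(d)=(m,q,c)$, $q\neq p$, $bufE_q(d)=(m,q',c)$ and $nextHop_q(d)\ne p$: $bufR_p(d):=\varepsilon$. - $(R_6)$ If $p=d$ and $bufE_p(p)=(m,q,c)$: deliver $m$; $bufE_p(p):=\varepsilon$. $\mathcal{SSMFP}_1$ runs simultaneously with $\mathcal A$, which has priority: a selected processor with an enabled action of $\mathcal A$ executes one such action and nothing else. The instances of $\mathcal{SSMFP}_1$ for the different destinations run simultaneously: any other selected processor executes, for every $d$ for which one of its rules is enabled,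 one of these enabled rules. Processor $p$ *emits* when it executes $(R_1)$, for any destination. **Proposition.** There is a universal constant $C$ such that, for every network, every such $\mathcal A$, every set of useful informations and every execution of $\mathcal{SSMFP}_1$ together with $\mathcal A$ from an arbitrary initial configuration, with $K=C\cdot\max(R_{\mathcal A},\Delta^{D})$ and for every processor $p$: 1. (Delay) If $p$ has a waiting message ($request_p$ is true) in a configuration $\gamma$ before which it has not emitted, then its first emission takes place within $K$ rounds counted from $\gamma$. 2. (Waiting time) If $p$ has emitted and has not emitted again before a later configuration $\gamma$ in which it has a waiting message (for instance the configuration that immediately follows the emission, if the higher layer requests again at once), then its next emission takes place within $K$ rounds counted from $\gamma$. Hence the delay and the waiting time between two consecutive emissions are $O(\max(R_{\mathcal A},\Delta^{D}))$ rounds in the worst case. -/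

import Mathlib

universe u v w x

namespace SSMFP

set_option linter.checkUnivs false

/-! ### The state model: executions, weakly fair distributed daemon, rounds -/

/-- A distributed system in the local shared memory model. `V` is the set of processors, `C` the set
of configurations, `L` the set of action labels. `Guard γ p l`: the action `l` of processor `p` is
enabled in `γ`. `Step γ a γ'`: if every processor `p` with `a p = some l` executes its action `l`
(simultaneously, all guards and statements being evaluated in `γ`) and every processor `p` with
`a p = none` executes nothing, then `γ'` is a possible next configuration. -/
structure System (V : Type u) (C : Type v) (L : Type w) where
  Guard : C → V → L → Prop
  Step : C → (V → Option L) → C → Prop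

/-- A processor is enabled if at least one of its actions is. -/
def System.Enabled {V : Type u} {C : Type v} {L : Type w} (P : System V C L) (γ : C) (p : V) :
    Prop :=
  ∃ l, P.Guard γ p l

/-- A maximal execution under a distributed, weakly fair daemon. The initial configuration is
arbitrary. A finite maximal execution is represented by letting its terminal configuration idle:
the daemon selects nobody only if nobody is enabled. -/
structure Execution {V : Type u} {C : Type v} {L : Type w} (P : System V C L) where
  conf : ℕ → C
  /-- `act i p` is the action executed by `p` in the step from `conf i` to `conf (i + 1)`. -/
  act : ℕ → V → Option L
  act_enabled : ∀ i p l, act i p = some l → P.Guard (conf i) p l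
  distributed : ∀ i, (∃ p, P.Enabled (conf i) p) → ∃ p, act i p ≠ none
  step : ∀ i, P.Step (conf i) (act i) (conf (i + 1))
  weaklyFair : ∀ p i, (∀ j, i ≤ j → P.Enabled (conf j) p) → ∃ j, i ≤ j ∧ act j p ≠ none

section Rounds

variable {V : Type u} {C : Type v} {L : Type w} {P : System V C L}

/-- `p` is neutralized in step `i`: it was enabled, it executes nothing, and it is no longer
enabled. -/
def Execution.Neutralized (e : Execution P) (i : ℕ) (p : V) : Prop :=
  P.Enabled (e.conf i) p ∧ e.act i p = none ∧ ¬ P.Enabled (e.conf (i + 1)) p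

/-- The first round of the execution suffix that starts at `conf i` ends at `conf j`: it is the
minimal (nonempty) portion of the execution in which every processor enabled in `conf i` executes
an action or is neutralized. -/
def Execution.IsRoundEnd (e : Execution P) (i j : ℕ) : Prop :=
  IsLeast {j | i < j ∧ ∀ p, P.Enabled (e.conf i) p →
    ∃ k, i ≤ k ∧ k < j ∧ (e.act k p ≠ none ∨ e.Neutralized k p)} j

/-- `e.AfterRounds i K b`: the first `K` rounds of the suffix that starts at `conf i` consist of
the steps `i, …, b - 1`, so that they end at `conf b`. -/
inductive Execution.AfterRounds (e : Execution P) (i : ℕ) : ℕ → ℕ → Prop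
  | zero : Execution.AfterRounds e i 0 i
  | succ {K b b' : ℕ} : Execution.AfterRounds e i K b → e.IsRoundEnd b b' →
      Execution.AfterRounds e i (K + 1) b'

end Rounds

/-! ### The routing algorithm -/

/-- An algorithm of the local shared memory model on the network `G` that maintains routing tables.
Guards and statements of `p` depend only on the states of `p` and of its neighbours, and a
statement writes the state of `p` only. `nextHop p s d` is the entry for the destination `d` of the
routing table of `p` when the state of `p` is `s`: it is a neighbour of `p`, in whatever state, if
`p ≠ d` (the entry of a processor for itself is arbitrary). -/
structure RoutingAlgorithm {V : Type u} (G : SimpleGraph V) where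
  State : V → Type w
  Label : Type x
  guard : V → Label → (∀ q, State q) → Prop
  stmt : ∀ p : V, Label → (∀ q, State q) → State p
  guard_local : ∀ p l (σ τ : ∀ q, State q), (∀ q, q = p ∨ G.Adj p q → σ q = τ q) →
    (guard p l σ ↔ guard p l τ)
  stmt_local : ∀ p l (σ τ : ∀ q, State q), (∀ q, q = p ∨ G.Adj p q → σ q = τ q) →
    stmt p l σ = stmt p l τ
  nextHop : ∀ p : V, State p → V → V
  nextHop_adj : ∀ p s d, p ≠ d → G.Adj p (nextHop p s d)

namespace RoutingAlgorithm

variable {V : Type u} {G : SimpleGraph V}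

/-- The routing algorithm running alone. -/
def system (A : RoutingAlgorithm.{u, w, x} G) : System V (∀ p, A.State p) A.Label where
  Guard σ p l := A.guard p l σ
  Step σ a σ' := ∀ p, σ' p = match a p with
    | some l => A.stmt p l σ
    | none => σ p

/-- The routing tables are correct: they induce minimal paths (in number of edges). -/
def Correct (A : RoutingAlgorithm.{u, w, x} G) (σ : ∀ p, A.State p) : Prop :=
  ∀ p d, p ≠ d → G.dist (A.nextHop p (σ p) d) d + 1 = G.dist p d

/-- The algorithm is self-stabilizing and silent, and its stabilization time is at most `R` rounds:
from any configuration, under a distributed weakly fair daemon, after `R` rounds the routing tables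
are correct and no action is enabled. -/
def StabilizesWithin (A : RoutingAlgorithm.{u, w, x} G) (R : ℕ) : Prop :=
  ∀ e : Execution A.system, ∃ b, e.AfterRounds 0 R b ∧
    A.Correct (e.conf b) ∧ ∀ p, ¬ A.system.Enabled (e.conf b) p

end RoutingAlgorithm

/-! ### The forwarding protocol -/

/-- A message `(m, q, c)` as stored in a buffer: useful information `m`, last processor crossed
`q`, colour `c ∈ {0, …, Δ}`. Its destination is the index of the buffer. -/
@[ext]
structure Message (V : Type u) (M : Type v) (Δ : ℕ) where
  info : M
  last : V
  color : Fin (Δ + 1)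

/-- The variables of the composition of the routing algorithm and the forwarding protocol. -/
structure Vars {V : Type u} {G : SimpleGraph V} (A : RoutingAlgorithm.{u, w, x} G) (M : Type v)
    (Δ : ℕ) where
  /-- the state of the routing algorithm -/
  tab : ∀ p, A.State p
  /-- `bufR p d`: reception buffer of `p` for the destination `d` (`none` if empty) -/
  bufR : V → V → Option (Message V M Δ)
  /-- `bufE p d`: emission buffer of `p` for the destination `d` (`none` if empty) -/
  bufE : V → V → Option (Message V M Δ)
  /-- `req p = some (m, d)`: the request bit of `p` is true, and the message waiting in the higher
  layer of `p` is `m`, with destination `d`; `req p = none`: the request bit is false -/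
  req : V → Option (M × V)
  /-- `queue p d`: the queue that implements the fair choice for the buffer `bufR p d` -/
  queue : V → V → List V

section Protocol

variable {V : Type u} {G : SimpleGraph V} {A : RoutingAlgorithm.{u, w, x} G} {M : Type v} {Δ : ℕ}

/-- The next hop of `p` for the destination `d`, read in the current routing table of `p`. -/
def Vars.hop (γ : Vars A M Δ) (p d : V) : V := A.nextHop p (γ.tab p) d

/-- `s` can forward (if it is a neighbour of `p`) or generate (if it is `p`) a message of
destination `d` in `bufR p d`. -/
def Vars.Candidate (γ : Vars A M Δ) (p d s : V) : Prop :=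
  (G.Adj p s ∧ γ.bufE s d ≠ none ∧ γ.hop s d = p) ∨ (s = p ∧ ∃ m, γ.req p = some (m, d))

/-- The buffer content `b` is a message with useful information `m` and colour `c`. -/
def Carries (b : Option (Message V M Δ)) (m : M) (c : Fin (Δ + 1)) : Prop :=
  ∃ q, b = some ⟨m, q, c⟩

/-- A configuration: arbitrary values of the variables within their domains. The last processor
crossed by a message stored by `p` is `p` or a neighbour of `p`; the queue `queue p d` consists of
the current candidates for `bufR p d`, without repetition, in an arbitrary order. -/
structure Config {V : Type u} {G : SimpleGraph V} (A : RoutingAlgorithm.{u, w, x} G) (M : Type v)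
    (Δ : ℕ) extends Vars A M Δ where
  bufR_last : ∀ p d μ, bufR p d = some μ → μ.last = p ∨ G.Adj p μ.last
  bufE_last : ∀ p d μ, bufE p d = some μ → μ.last = p ∨ G.Adj p μ.last
  queue_nodup : ∀ p d, (queue p d).Nodup
  mem_queue : ∀ p d s, s ∈ queue p d ↔ toVars.Candidate p d s

/-- The processor selected by `p` among the candidates for `bufR p d`, if there is one: the head of
the queue. -/
def Vars.choice (γ : Vars A M Δ) (p d : V) : Option V := (γ.queue p d).head?

/-- The rules of the forwarding protocol: generation, internal forwarding, forwarding, erasing after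
forwarding, erasing after duplication, consumption. -/
inductive Rule
  | R1 | R2 | R3 | R4 | R5 | R6

/-- The guard of a rule of processor `p` for the destination `d`. -/
def Vars.RuleGuard (γ : Vars A M Δ) (p d : V) : Rule → Prop
  | .R1 => (∃ m, γ.req p = some (m, d)) ∧ γ.bufR p d = none ∧ γ.choice p d = some p
  | .R2 => γ.bufE p d = none ∧ ∃ m q c, γ.bufR p d = some ⟨m, q, c⟩ ∧
      (q = p ∨ ¬ Carries (γ.bufE q d) m c)
  | .R3 => γ.bufR p d = none ∧ ∃ s, γ.choice p d = some s ∧ s ≠ p ∧ γ.bufE s d ≠ none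
  | .R4 => p ≠ d ∧ ∃ m q c, γ.bufE p d = some ⟨m, q, c⟩ ∧
      γ.bufR (γ.hop p d) d = some ⟨m, p, c⟩ ∧
      ∀ r, G.Adj p r → r ≠ γ.hop p d → γ.bufR r d ≠ some ⟨m, p, c⟩
  | .R5 => ∃ m q c, γ.bufR p d = some ⟨m, q, c⟩ ∧ q ≠ p ∧ Carries (γ.bufE q d) m c ∧
      γ.hop q d ≠ p
  | .R6 => p = d ∧ γ.bufE p d ≠ none

/-- `γ.RuleEffect p d r R' E'`: `R'` and `E'` are possible contents of `bufR p d` and `bufE p d`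
after `p` has executed, for the destination `d`, the rule `r` (nothing, if `r = none`). In rule `R2`
the new colour is any colour not carried by a message in a reception buffer of a neighbour. -/
def Vars.RuleEffect (γ : Vars A M Δ) (p d : V) (r : Option Rule)
    (R' E' : Option (Message V M Δ)) : Prop :=
  match r with
  | none => R' = γ.bufR p d ∧ E' = γ.bufE p d
  | some .R1 => (∃ m, γ.req p = some (m, d) ∧ R' = some ⟨m, p, 0⟩) ∧ E' = γ.bufE p d
  | some .R2 => R' = none ∧ ∃ m q c c', γ.bufR p d = some ⟨m, q, c⟩ ∧ E' = some ⟨m, p, c'⟩ ∧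
      ∀ s, G.Adj p s → ∀ μ, γ.bufR s d = some μ → μ.color ≠ c'
  | some .R3 => (∃ s m q c, γ.choice p d = some s ∧ γ.bufE s d = some ⟨m, q, c⟩ ∧
      R' = some ⟨m, s, c⟩) ∧ E' = γ.bufE p d
  | some .R4 => R' = γ.bufR p d ∧ E' = none
  | some .R5 => R' = none ∧ E' = γ.bufE p d
  | some .R6 => R' = γ.bufR p d ∧ E' = none

/-- What an activated processor executes: one action of the routing algorithm, or, the instances of
the forwarding protocol for the different destinations running simultaneously, at most one rule for
every destination. -/
inductive Move (V : Type u) (T : Type x)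
  | table (l : T)
  | forward (r : V → Option Rule)

/-- The rule, if any, that `p` executes for the destination `d`. -/
def ruleOf {T : Type x} (a : V → Option (Move V T)) (p d : V) : Option Rule :=
  match a p with
  | some (.forward r) => r d
  | _ => none

/-- The guard of a move. The routing algorithm has priority: a processor with an enabled action of
the routing algorithm executes such an action. Otherwise it executes, for every destination for
which one of its rules is enabled, one of these enabled rules (there must be such a destination). -/
def Vars.MoveGuard (γ : Vars A M Δ) (p : V) : Move V A.Label → Prop
  | .table l => A.guard p l γ.tab
  | .forward r => (∀ l, ¬ A.guard p l γ.tab) ∧ (∃ d, r d ≠ none) ∧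
      ∀ d, match r d with
        | some k => γ.RuleGuard p d k
        | none => ∀ k, ¬ γ.RuleGuard p d k

open Classical in
/-- The step relation of the composition.
* Tables and buffers change as prescribed by the executed actions.
* The request bit of `p` becomes false when `p` executes `R1`. The higher layer can set it to true,
  with any waiting message, when it is false; as long as it is true, it waits with the same message.
* In the queue for `bufR p d`, a processor whose message enters `bufR p d` (by `R1` or `R3`) loses
  its place, the processors that are not candidates any more are removed, the others keep their
  order, and the missing candidates are added at the end, in an arbitrary order. -/
def Vars.StepRel (γ : Vars A M Δ) (a : V → Option (Move V A.Label)) (γ' : Vars A M Δ) : Prop :=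
  (∀ p, γ'.tab p = match a p with
    | some (.table l) => A.stmt p l γ.tab
    | _ => γ.tab p) ∧
  (∀ p d, γ.RuleEffect p d (ruleOf a p d) (γ'.bufR p d) (γ'.bufE p d)) ∧
  (∀ p, γ.req p ≠ none → (∀ d, ruleOf a p d ≠ some .R1) → γ'.req p = γ.req p) ∧
  (∀ p d, ∃ new : List V, γ'.queue p d =
    (if ruleOf a p d = some .R1 ∨ ruleOf a p d = some .R3 then (γ.queue p d).tail
      else γ.queue p d).filter (fun s => decide (γ'.Candidate p d s)) ++ new)

end Protocol

/-- The protocol `SSMFP₁` (with colours `0, …, Δ`) running simultaneously with the routing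
algorithm `A`, which has priority. -/
def ssmfp {V : Type u} {G : SimpleGraph V} (A : RoutingAlgorithm.{u, w, x} G) (M : Type v)
    (Δ : ℕ) : System V (Config A M Δ) (Move V A.Label) where
  Guard γ p μ := γ.toVars.MoveGuard p μ
  Step γ a γ' := γ.toVars.StepRel a γ'.toVars

section Emission

variable {V : Type u} {G : SimpleGraph V} {A : RoutingAlgorithm.{u, w, x} G} {M : Type v} {Δ : ℕ}

/-- `p` emits (generates) a message in step `i`: it executes `R1` for some destination. -/
def Emits (e : Execution (ssmfp A M Δ)) (i : ℕ) (p : V) : Prop :=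
  ∃ d, ruleOf (e.act i) p d = some .R1

/-- `p` has a waiting message in `conf i`: its request bit is true. -/
def Requests (e : Execution (ssmfp A M Δ)) (i : ℕ) (p : V) : Prop :=
  (e.conf i).req p ≠ none

/-- The next emission of `p`, from `conf i` on, exists and takes place during the first `K` rounds
counted from `conf i`. -/
def EmitsWithin (e : Execution (ssmfp A M Δ)) (i K : ℕ) (p : V) : Prop :=
  ∃ j b, i ≤ j ∧ j < b ∧ e.AfterRounds i K b ∧ Emits e j p ∧ ∀ k, i ≤ k → k < j → ¬ Emits e k p

/-- Every delay of the execution is at most `K` rounds: if `p` has a waiting message in `conf i` and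
has not emitted before, then its first emission takes place within `K` rounds from `conf i`. -/
def DelayAtMost (e : Execution (ssmfp A M Δ)) (K : ℕ) : Prop :=
  ∀ p i, Requests e i p → (∀ k, k < i → ¬ Emits e k p) → EmitsWithin e i K p

/-- Every waiting time of the execution is at most `K` rounds: if `p` emits in step `i`, does not
emit in the steps between `i` and `j`, and has a waiting message in `conf j`, where `i < j`
(`j = i + 1` if the higher layer requests again at once), then its next emission takes place within
`K` rounds from `conf j`. -/
def WaitingTimeAtMost (e : Execution (ssmfp A M Δ)) (K : ℕ) : Prop :=
  ∀ p i j, Emits e i p → i < j → (∀ k, i < k → k < j → ¬ Emits e k p) → Requests e j p →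
    EmitsWithin e j K p

end Emission

end SSMFP

namespace SSMFP

/-! ### Rounds -/

section RoundsTheory

variable {V : Type u} {C : Type v} {L : Type w} {P : System V C L}

/-! Fix a configuration in which `p` has a waiting message. Because the routing algorithm has
priority, its active steps form an execution of it alone whose rounds are no slower
(`tableExecution_rounds_le`). So after `R` rounds the tables are correct and frozen
(`settled_of_stabilizesWithin`), and either `p` has emitted or the same message still waits.

With frozen tables, a message in an emission buffer that its next hop has copied is erased within 5
rounds, whatever its distance to the destination (`copied_erased`). Hence a reception buffer empties
6 rounds after the bound for the emission buffer of the same processor (`bufR_empties`), and each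
place in a queue costs that time plus 2 rounds (`within_of_queued`). An emission buffer at distance
`k + 1` waits in the queue of a processor at distance `k`, so induction on the distance
(`bufE_empties`) multiplies the bound by a queue length at each hop.

A queue length of `Δ + 1` at every hop would be too much. At distance at least 2 the next hop is
never a candidate, which leaves `Δ`; at distance `D` only the processor and the destination can be
candidates, which leaves 2. With these savings the product, including the final wait in the queue of
`p` itself, is at most `192 * Δ ^ D`. Past emissions play no role, so delay and waiting time obey
the same bound. -/

theorem Execution.enabled_of_unresolved (e : Execution P) {p : V} {i j : ℕ} (hij : i ≤ j)
    (hp : P.Enabled (e.conf i) p)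
    (hno : ∀ k, i ≤ k → k < j → ¬ (e.act k p ≠ none ∨ e.Neutralized k p)) :
    P.Enabled (e.conf j) p := by
  induction j, hij using Nat.le_induction with
  | base => exact hp
  | succ j hij ih =>
    have hj := ih fun k hk hkj => hno k hk (by omega)
    have := hno j hij (by omega)
    by_contra hcon
    refine this ?_
    by_cases ha : e.act j p = none
    · exact Or.inr ⟨hj, ha, hcon⟩
    · exact Or.inl ha

/-- Weak fairness resolves each enabled processor at some finite time, and finiteness of `V` bounds
these times. -/
theorem Execution.exists_isRoundEnd [Finite V] (e : Execution P) (i : ℕ) :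
    ∃ j, e.IsRoundEnd i j := by
  have key : ∀ p, ∃ k, P.Enabled (e.conf i) p →
      i ≤ k ∧ (e.act k p ≠ none ∨ e.Neutralized k p) := by
    intro p
    by_contra! hcon
    have hp := (hcon i).1
    obtain ⟨j, hj, hact⟩ := e.weaklyFair p i fun j hj =>
      e.enabled_of_unresolved hj hp fun k hk _ hr => by
        have := (hcon k).2 hk
        rcases hr with hr | hr
        · exact hr this.1
        · exact this.2 hr
    exact hact ((hcon j).2 hj).1
  choose k hk using key
  obtain ⟨B, hB⟩ := (Set.finite_range k).bddAbove
  have hne : {j | i < j ∧ ∀ p, P.Enabled (e.conf i) p →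
      ∃ k, i ≤ k ∧ k < j ∧ (e.act k p ≠ none ∨ e.Neutralized k p)}.Nonempty := by
    refine ⟨max B i + 1, Nat.lt_succ_of_le (le_max_right _ _), fun p hp => ?_⟩
    have : k p ≤ B := hB ⟨p, rfl⟩
    exact ⟨k p, (hk p hp).1, by omega, (hk p hp).2⟩
  exact ⟨sInf _, Nat.sInf_mem hne, fun _ hj => Nat.sInf_le hj⟩

/-- The configuration index at which the first round of the suffix starting at `i` ends. -/
noncomputable def Execution.roundEnd [Finite V] (e : Execution P) (i : ℕ) : ℕ :=
  (e.exists_isRoundEnd i).choose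

variable [Finite V] (e : Execution P)

theorem Execution.isRoundEnd_roundEnd (i : ℕ) : e.IsRoundEnd i (e.roundEnd i) :=
  (e.exists_isRoundEnd i).choose_spec

theorem Execution.lt_roundEnd (i : ℕ) : i < e.roundEnd i :=
  (e.isRoundEnd_roundEnd i).1.1

theorem Execution.exists_resolved {i : ℕ} {p : V} (hp : P.Enabled (e.conf i) p) :
    ∃ k, i ≤ k ∧ k < e.roundEnd i ∧ (e.act k p ≠ none ∨ e.Neutralized k p) :=
  (e.isRoundEnd_roundEnd i).1.2 p hp

theorem Execution.roundEnd_le {i j : ℕ} (hij : i < j)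
    (h : ∀ p, P.Enabled (e.conf i) p →
      ∃ k, i ≤ k ∧ k < j ∧ (e.act k p ≠ none ∨ e.Neutralized k p)) : e.roundEnd i ≤ j :=
  (e.isRoundEnd_roundEnd i).2 ⟨hij, h⟩

/-- A processor enabled at `i` is resolved before `j` or is still enabled at `j`, and is then
resolved in the round that starts there. This monotonicity is what lets round bounds be added
although intermediate events fall inside rounds. -/
theorem Execution.roundEnd_mono : Monotone e.roundEnd := by
  intro i j hij
  refine e.roundEnd_le (hij.trans_lt (e.lt_roundEnd j)) fun p hp => ?_
  by_cases hno : ∀ k, i ≤ k → k < j → ¬ (e.act k p ≠ none ∨ e.Neutralized k p)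
  · obtain ⟨k, hk, hkj, hr⟩ := e.exists_resolved (e.enabled_of_unresolved hij hp hno)
    exact ⟨k, hij.trans hk, hkj, hr⟩
  · simp only [not_forall] at hno
    obtain ⟨k, hk, hkj, hr⟩ := hno
    exact ⟨k, hk, hkj.trans (e.lt_roundEnd j), not_not.1 hr⟩

/-- The configuration index reached after `K` rounds counted from `i`. -/
noncomputable def Execution.rounds (i K : ℕ) : ℕ := e.roundEnd^[K] i

theorem Execution.rounds_succ (i K : ℕ) : e.rounds i (K + 1) = e.roundEnd (e.rounds i K) :=
  Function.iterate_succ_apply' _ _ _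

theorem Execution.rounds_add (i K K' : ℕ) :
    e.rounds i (K + K') = e.rounds (e.rounds i K) K' := by
  rw [Execution.rounds, add_comm, Function.iterate_add_apply]; rfl

theorem Execution.rounds_mono_left (K : ℕ) : Monotone fun i => e.rounds i K :=
  e.roundEnd_mono.iterate K

theorem Execution.rounds_strictMono (i : ℕ) : StrictMono (e.rounds i) :=
  strictMono_nat_of_lt_succ fun K => by rw [e.rounds_succ]; exact e.lt_roundEnd _

theorem Execution.le_rounds (i K : ℕ) : i ≤ e.rounds i K :=
  (e.rounds_strictMono i).monotone (Nat.zero_le K)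

theorem Execution.afterRounds_rounds (i K : ℕ) : e.AfterRounds i K (e.rounds i K) := by
  induction K with
  | zero => exact .zero
  | succ K ih => rw [e.rounds_succ]; exact .succ ih (e.isRoundEnd_roundEnd _)

theorem Execution.AfterRounds.eq_rounds {e : Execution P} {i K b : ℕ}
    (h : e.AfterRounds i K b) : b = e.rounds i K := by
  induction h with
  | zero => rfl
  | succ _ hr ih => rw [e.rounds_succ, ← ih]; exact hr.unique (e.isRoundEnd_roundEnd _)

/-- Some configuration that satisfies `Q` is reached within `K` rounds counted from `t`. -/
def Execution.Within (t K : ℕ) (Q : ℕ → Prop) : Prop :=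
  ∃ s, t ≤ s ∧ s ≤ e.rounds t K ∧ Q s

variable {e}

theorem Execution.Within.of_now {t : ℕ} (K : ℕ) {Q : ℕ → Prop} (h : Q t) : e.Within t K Q :=
  ⟨t, le_rfl, e.le_rounds t K, h⟩

theorem Execution.Within.mono {t K K' : ℕ} {Q Q' : ℕ → Prop} (h : e.Within t K Q)
    (hK : K ≤ K') (hQ : ∀ s, t ≤ s → Q s → Q' s) : e.Within t K' Q' := by
  obtain ⟨s, hs, hs', hq⟩ := h
  exact ⟨s, hs, hs'.trans ((e.rounds_strictMono t).monotone hK), hQ s hs hq⟩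

theorem Execution.Within.trans {t K K' : ℕ} {Q Q' : ℕ → Prop} (h : e.Within t K Q)
    (hQ : ∀ s, t ≤ s → Q s → e.Within s K' Q') : e.Within t (K + K') Q' := by
  obtain ⟨s, hs, hs', hq⟩ := h
  obtain ⟨r, hr, hr', hq'⟩ := hQ s hs hq
  refine ⟨r, hs.trans hr, hr'.trans ?_, hq'⟩
  rw [e.rounds_add]
  exact e.rounds_mono_left K' hs'

end RoundsTheory

/-! ### Stabilization of the routing tables in the composition -/

section Projection

variable {V : Type u} {G : SimpleGraph V} {A : RoutingAlgorithm.{u, w, x} G} {M : Type v} {Δ : ℕ}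

/-- The action of the routing algorithm contained in a move. -/
def Move.tableAction {T : Type x} : Option (Move V T) → Option T
  | some (.table l) => some l
  | _ => none

/-- In step `t`, some processor executes an action of the routing algorithm. -/
def TableActive (e : Execution (ssmfp A M Δ)) (t : ℕ) : Prop :=
  ∃ p, Move.tableAction (e.act t p) ≠ none

variable (e : Execution (ssmfp A M Δ))

theorem tab_succ (t : ℕ) (p : V) : (e.conf (t + 1)).tab p =
    match Move.tableAction (e.act t p) with
    | some l => A.stmt p l (e.conf t).tab
    | none => (e.conf t).tab p := by
  have := (e.step t).1 p
  rw [this]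
  rcases e.act t p with _ | (l | r) <;> rfl

theorem tab_succ_of_not_active {t : ℕ} (h : ¬ TableActive e t) :
    (e.conf (t + 1)).tab = (e.conf t).tab := by
  funext p
  have hp : Move.tableAction (e.act t p) = none := by
    by_contra hne; exact h ⟨p, hne⟩
  rw [tab_succ, hp]

theorem tab_eq_of_not_active {s t : ℕ} (hst : s ≤ t)
    (h : ∀ k, s ≤ k → k < t → ¬ TableActive e k) : (e.conf t).tab = (e.conf s).tab := by
  induction t, hst using Nat.le_induction with
  | base => rfl
  | succ t hst ih =>
    rw [tab_succ_of_not_active e (h t hst (by omega)), ih fun k hk hkt => h k hk (by omega)]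

theorem guard_of_tableAction {t : ℕ} {p : V} {l : A.Label}
    (h : Move.tableAction (e.act t p) = some l) : A.guard p l (e.conf t).tab := by
  rcases ha : e.act t p with _ | (l' | r) <;> rw [ha] at h
  · cases h
  · cases h
    exact e.act_enabled t p _ ha
  · cases h

theorem enabled_of_table {t : ℕ} {p : V} (h : A.system.Enabled (e.conf t).tab p) :
    (ssmfp A M Δ).Enabled (e.conf t) p := by
  obtain ⟨l, hl⟩ := h
  exact ⟨.table l, hl⟩

theorem tableAction_ne_none {t : ℕ} {p : V} (h : A.system.Enabled (e.conf t).tab p)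
    (ha : e.act t p ≠ none) : Move.tableAction (e.act t p) ≠ none := by
  rcases hact : e.act t p with _ | (l' | r)
  · exact absurd hact ha
  · simp [Move.tableAction]
  · obtain ⟨l, hl⟩ := h
    exact absurd hl ((e.act_enabled t p _ hact).1 l)

/-- Resolution of the pending routing action of a processor. -/
def TableResolved (t : ℕ) (p : V) : Prop :=
  A.system.Enabled (e.conf t).tab p ∧ (Move.tableAction (e.act t p) ≠ none ∨
    Move.tableAction (e.act t p) = none ∧ ¬ A.system.Enabled (e.conf (t + 1)).tab p)

/-- Routing guards read the tables only, so a pending routing action can vanish only if some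
processor changes its table. -/
theorem TableResolved.active {e : Execution (ssmfp A M Δ)} {t : ℕ} {p : V}
    (h : TableResolved e t p) : TableActive e t := by
  rcases h with ⟨h1, h2 | ⟨-, h3⟩⟩
  · exact ⟨p, h2⟩
  · by_contra hcon
    rw [tab_succ_of_not_active e hcon] at h3
    exact h3 h1

theorem table_enabled_of_unresolved {p : V} {i j : ℕ} (hij : i ≤ j)
    (hp : A.system.Enabled (e.conf i).tab p)
    (hno : ∀ k, i ≤ k → k < j → ¬ TableResolved e k p) :
    A.system.Enabled (e.conf j).tab p := by
  induction j, hij using Nat.le_induction with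
  | base => exact hp
  | succ j hij ih =>
    have hj := ih fun k hk hkj => hno k hk (by omega)
    by_contra hcon
    refine hno j hij (by omega) ⟨hj, ?_⟩
    by_cases ha : Move.tableAction (e.act j p) = none
    · exact Or.inr ⟨ha, hcon⟩
    · exact Or.inl ha

/-- A pending routing action keeps its processor enabled in the composition, and by priority any
move of that processor is then a routing action. -/
theorem exists_tableResolved [Finite V] {i : ℕ} {p : V}
    (hp : A.system.Enabled (e.conf i).tab p) :
    ∃ k, i ≤ k ∧ k < e.roundEnd i ∧ TableResolved e k p := by
  by_contra! hno
  have hen : ∀ j, i ≤ j → j ≤ e.roundEnd i → A.system.Enabled (e.conf j).tab p :=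
    fun j hj hj' => table_enabled_of_unresolved e hj hp fun k hk hkj => hno k hk (by omega)
  obtain ⟨k, hk, hk', hr⟩ := e.exists_resolved (enabled_of_table e hp)
  rcases hr with hr | hr
  · exact hno k hk hk' ⟨hen k hk hk'.le, Or.inl (tableAction_ne_none e (hen k hk hk'.le) hr)⟩
  · exact hr.2.2 (enabled_of_table e (hen (k + 1) (by omega) hk'))

/-! ### Enumeration of the steps in which the routing algorithm acts -/

open Classical in
/-- The first step from `t` on in which the routing algorithm acts; `t` if there is none. -/
noncomputable def nextActive (t : ℕ) : ℕ :=
  if h : ∃ s, t ≤ s ∧ TableActive e s then Nat.find h else t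

theorem le_nextActive (t : ℕ) : t ≤ nextActive e t := by
  classical
  unfold nextActive
  split_ifs with h
  · exact (Nat.find_spec h).1
  · exact le_rfl

theorem not_active_of_lt_nextActive {t k : ℕ} (hk : t ≤ k) (hk' : k < nextActive e t) :
    ¬ TableActive e k := by
  classical
  unfold nextActive at hk'
  split_ifs at hk' with h
  · exact fun ha => Nat.find_min h hk' ⟨hk, ha⟩
  · omega

theorem nextActive_le {t s : ℕ} (hs : t ≤ s) (ha : TableActive e s) : nextActive e t ≤ s := by
  by_contra! hlt
  exact not_active_of_lt_nextActive e hs hlt ha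

theorem active_nextActive {t s : ℕ} (hs : t ≤ s) (ha : TableActive e s) :
    TableActive e (nextActive e t) := by
  classical
  have h : ∃ s, t ≤ s ∧ TableActive e s := ⟨s, hs, ha⟩
  unfold nextActive
  rw [dif_pos h]
  exact (Nat.find_spec h).2

theorem tab_nextActive (t : ℕ) : (e.conf (nextActive e t)).tab = (e.conf t).tab :=
  tab_eq_of_not_active e (le_nextActive e t) fun _ hk hk' => not_active_of_lt_nextActive e hk hk'

/-- The successive steps, from `i` on, in which the routing algorithm acts. -/
noncomputable def activeTime (i : ℕ) : ℕ → ℕ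
  | 0 => nextActive e i
  | n + 1 => nextActive e (activeTime i n + 1)

theorem activeTime_strictMono (i : ℕ) : StrictMono (activeTime e i) :=
  strictMono_nat_of_lt_succ fun _ => le_nextActive e _

theorem le_activeTime (i n : ℕ) : i ≤ activeTime e i n :=
  (le_nextActive e i).trans ((activeTime_strictMono e i).monotone (Nat.zero_le n))

theorem exists_le_activeTime (i t : ℕ) : ∃ n, t ≤ activeTime e i n :=
  ⟨t, (activeTime_strictMono e i).le_apply⟩

open Classical in
/-- The number of steps before `t` listed by `activeTime`. -/
noncomputable def activeCount (i t : ℕ) : ℕ := Nat.find (exists_le_activeTime e i t)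

theorem le_activeTime_activeCount (i t : ℕ) : t ≤ activeTime e i (activeCount e i t) := by
  classical exact Nat.find_spec (exists_le_activeTime e i t)

theorem activeTime_lt {i t n : ℕ} (h : n < activeCount e i t) : activeTime e i n < t := by
  classical
  have := Nat.find_min (exists_le_activeTime e i t) h
  omega

/-- No active step lies between `t` and the first listed time from `t` on. The right alternative
covers the idle tail, where `nextActive` returns its argument and the enumeration advances by single
steps. -/
theorem activeTime_activeCount {i t : ℕ} (hit : i ≤ t) :
    activeTime e i (activeCount e i t) = nextActive e t ∨
      activeTime e i (activeCount e i t) = t := by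
  have h1 := le_activeTime_activeCount e i t
  by_cases hex : ∃ k, t ≤ k ∧ k < activeTime e i (activeCount e i t) ∧ TableActive e k
  · obtain ⟨k, hk, hk', ha⟩ := hex
    exfalso
    rcases hn : activeCount e i t with _ | n
    · rw [hn] at hk'
      exact not_active_of_lt_nextActive e (hit.trans hk) hk' ha
    · rw [hn] at hk'
      have := activeTime_lt e (i := i) (t := t) (n := n) (by omega)
      exact not_active_of_lt_nextActive e (by omega) hk' ha
  · push Not at hex
    by_cases hact : TableActive e (activeTime e i (activeCount e i t))
    · left
      refine le_antisymm ?_ (nextActive_le e h1 hact)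
      by_contra! hlt
      exact hex _ (le_nextActive e t) hlt (active_nextActive e h1 hact)
    · right
      rcases hn : activeCount e i t with _ | n
      · rw [hn] at hact h1
        have : ¬ ∃ s, i ≤ s ∧ TableActive e s := fun ⟨s, hs, ha⟩ =>
          hact (active_nextActive e hs ha)
        have h0 : activeTime e i 0 = i := by
          simp only [activeTime, nextActive, dif_neg this]
        omega
      · rw [hn] at hact h1
        have hlt := activeTime_lt e (i := i) (t := t) (n := n) (by omega)
        have : ¬ ∃ s, activeTime e i n + 1 ≤ s ∧ TableActive e s := fun ⟨s, hs, ha⟩ =>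
          hact (active_nextActive e hs ha)
        have h0 : activeTime e i (n + 1) = activeTime e i n + 1 := by
          simp only [activeTime, nextActive, dif_neg this]
        omega

theorem tab_activeTime_activeCount {i t : ℕ} (hit : i ≤ t) :
    (e.conf (activeTime e i (activeCount e i t))).tab = (e.conf t).tab := by
  rcases activeTime_activeCount e hit with h | h <;> rw [h]
  exact tab_nextActive e t

theorem activeTime_activeCount_of_active {i t : ℕ} (hit : i ≤ t) (ha : TableActive e t) :
    activeTime e i (activeCount e i t) = t := by
  rcases activeTime_activeCount e hit with h | h <;> rw [h]
  exact le_antisymm (nextActive_le e le_rfl ha) (le_nextActive e t)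

theorem exists_active_of_enabled [Finite V] {i n : ℕ} {p : V}
    (hp : A.system.Enabled (e.conf (activeTime e i n)).tab p) :
    TableActive e (activeTime e i n) := by
  obtain ⟨k, hk, -, hr⟩ := exists_tableResolved e hp
  have ha := hr.active
  rcases n with _ | n
  · exact active_nextActive e ((le_nextActive e i).trans hk) ha
  · exact active_nextActive e ((le_nextActive e _).trans hk) ha

/-- The execution of the routing algorithm alone that is embedded in the suffix, starting at `i`,
of an execution of the composition. -/
noncomputable def tableExecution [Finite V] (i : ℕ) : Execution A.system where
  conf n := (e.conf (activeTime e i n)).tab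
  act n p := Move.tableAction (e.act (activeTime e i n) p)
  act_enabled _ _ _ h := guard_of_tableAction e h
  distributed _ h := by
    obtain ⟨p, hp⟩ := h
    exact exists_active_of_enabled e hp
  step n p := by
    change (e.conf (nextActive e (activeTime e i n + 1))).tab p = _
    rw [tab_nextActive, tab_succ]
  weaklyFair p n h := by
    have hp := h n le_rfl
    obtain ⟨s, hs, -, hr⟩ := exists_tableResolved e hp
    have hi := (le_activeTime e i n).trans hs
    have hts := activeTime_activeCount_of_active e hi hr.active
    have hle : n ≤ activeCount e i s := by
      rw [← (activeTime_strictMono e i).le_iff_le, hts]; exact hs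
    refine ⟨activeCount e i s, hle, ?_⟩
    rw [hts]
    rcases hr.2 with hr | hr
    · exact hr
    · refine absurd (h (activeCount e i s + 1) (by omega)) ?_
      change ¬ A.system.Enabled (e.conf (nextActive e (activeTime e i (activeCount e i s) + 1))).tab p
      rw [tab_nextActive, hts]
      exact hr.2

/-- A round of the composition resolves every routing action pending at its start, and each
resolution happens at a listed step; so its image contains a round of the projected execution. The
left alternative is split off because, with nothing pending, this argument yields no active step
that advances the count. -/
theorem tableExecution_rounds_le [Finite V] (i K : ℕ) :
    (∀ p, ¬ A.system.Enabled (e.conf (e.rounds i K)).tab p) ∨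
      (tableExecution e i).rounds 0 K ≤ activeCount e i (e.rounds i K) := by
  induction K with
  | zero => right; exact Nat.zero_le _
  | succ K ih =>
    by_cases hterm : ∀ p, ¬ A.system.Enabled (e.conf (e.rounds i K)).tab p
    · left
      intro p
      have : ∀ k, e.rounds i K ≤ k → (∀ q, ¬ A.system.Enabled (e.conf k).tab q) := by
        intro k hk
        induction k, hk using Nat.le_induction with
        | base => exact hterm
        | succ k hk ihk =>
          rwa [tab_succ_of_not_active e]
          rintro ⟨q, hq⟩
          obtain ⟨l, hl⟩ := Option.ne_none_iff_exists'.1 hq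
          exact ihk q ⟨l, guard_of_tableAction e hl⟩
      exact this _ ((e.rounds_strictMono i).monotone (Nat.le_succ K)) p
    · right
      have ih := ih.resolve_left hterm
      push Not at hterm
      rw [Execution.rounds_succ, Execution.rounds_succ]
      set T := e.rounds i K with hT
      have hiT : i ≤ T := e.le_rounds i K
      refine ((tableExecution e i).roundEnd_mono ih).trans ?_
      have key : ∀ p, A.system.Enabled (e.conf T).tab p →
          ∃ k, activeCount e i T ≤ k ∧ k < activeCount e i (e.roundEnd T) ∧
            ((tableExecution e i).act k p ≠ none ∨ (tableExecution e i).Neutralized k p) := by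
        intro p hp
        obtain ⟨s, hs, hs', hr⟩ := exists_tableResolved e hp
        have hts := activeTime_activeCount_of_active e (hiT.trans hs) hr.active
        refine ⟨activeCount e i s, ?_, ?_, ?_⟩
        · by_contra! hlt
          have := activeTime_lt e hlt
          omega
        · rw [← (activeTime_strictMono e i).lt_iff_lt, hts]
          exact hs'.trans_le (le_activeTime_activeCount e i _)
        · have hconf : (tableExecution e i).conf (activeCount e i s) = (e.conf s).tab := by
            change (e.conf (activeTime e i _)).tab = _
            rw [hts]
          have hconf' : (tableExecution e i).conf (activeCount e i s + 1)
              = (e.conf (s + 1)).tab := by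
            change (e.conf (nextActive e (activeTime e i _ + 1))).tab = _
            rw [tab_nextActive, hts]
          have hact : (tableExecution e i).act (activeCount e i s) p
              = Move.tableAction (e.act s p) := by
            change Move.tableAction (e.act (activeTime e i _) p) = _
            rw [hts]
          rw [Execution.Neutralized, hconf, hconf', hact]
          exact hr.2.imp_right fun h => ⟨hr.1, h⟩
      refine (tableExecution e i).roundEnd_le ?_ fun p hp => key p ?_
      -- One pending processor suffices to make the image of the round nonempty.
      · obtain ⟨p, hp⟩ := hterm
        obtain ⟨k, hk, hk', -⟩ := key p hp
        omega
      · rwa [← tab_activeTime_activeCount e hiT]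

/-- From `τ` on, the routing tables are `σ`, which is correct and terminal. -/
structure Settled (e : Execution (ssmfp A M Δ)) (τ : ℕ) (σ : ∀ p, A.State p) : Prop where
  tab_eq : ∀ t, τ ≤ t → (e.conf t).tab = σ
  silent : ∀ p l, ¬ A.guard p l σ
  correct : A.Correct σ

theorem tab_eq_of_terminal {P : Execution A.system} {n : ℕ}
    (h : ∀ p, ¬ A.system.Enabled (P.conf n) p) {m : ℕ} (hm : n ≤ m) : P.conf m = P.conf n := by
  induction m, hm using Nat.le_induction with
  | base => rfl
  | succ m hm ih =>
    rw [← ih]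
    funext p
    rw [P.step m p]
    rcases ha : P.act m p with _ | l
    · rfl
    · exact absurd ⟨l, ih ▸ P.act_enabled m p l ha⟩ (h p)

/-- The stabilization hypothesis allows any initial configuration, so it applies to the projection
of the suffix from `i`. -/
theorem settled_of_stabilizesWithin [Finite V] {R : ℕ} (hA : A.StabilizesWithin R) (i : ℕ) :
    ∃ σ, Settled e (e.rounds i R) σ := by
  obtain ⟨b, hb, hcorr, hterm⟩ := hA (tableExecution e i)
  have hb := hb.eq_rounds
  have hiT : i ≤ e.rounds i R := e.le_rounds i R
  set T := e.rounds i R with hT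
  have hconf : (tableExecution e i).conf (activeCount e i T) = (e.conf T).tab :=
    tab_activeTime_activeCount e hiT
  -- Both indices are compared through a terminal configuration: whichever comes first is terminal,
  -- or the end of the projected rounds is already passed, and terminal tables never change.
  have heq : (tableExecution e i).conf b = (e.conf T).tab := by
    rw [← hconf]
    rcases tableExecution_rounds_le e i R with h | h
    · rcases le_total (activeCount e i T) b with hle | hle
      · exact tab_eq_of_terminal (fun p => hconf ▸ h p) hle
      · exact (tab_eq_of_terminal hterm hle).symm
    · exact (tab_eq_of_terminal hterm (hb ▸ h)).symm
  rw [heq] at hcorr hterm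
  refine ⟨(e.conf T).tab, fun t ht => ?_, fun p l hl => hterm p ⟨l, hl⟩, hcorr⟩
  induction t, ht using Nat.le_induction with
  | base => rfl
  | succ t ht ih =>
    rw [tab_succ_of_not_active e, ih]
    rintro ⟨q, hq⟩
    obtain ⟨l, hl⟩ := Option.ne_none_iff_exists'.1 hq
    exact hterm q ⟨l, ih ▸ guard_of_tableAction e hl⟩

end Projection

/-! ### Forwarding once the routing tables are settled -/

section Forwarding

variable {V : Type u} {G : SimpleGraph V} {A : RoutingAlgorithm.{u, w, x} G} {M : Type v} {Δ : ℕ}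

/-- The next hop of `p` towards `d` in the tables `σ`. -/
def hopOf (σ : ∀ p, A.State p) (d p : V) : V := A.nextHop p (σ p) d

theorem hopOf_adj (σ : ∀ p, A.State p) {p d : V} (hp : p ≠ d) : G.Adj p (hopOf σ d p) :=
  A.nextHop_adj p (σ p) d hp

variable {e : Execution (ssmfp A M Δ)} {τ : ℕ} {σ : ∀ p, A.State p}

theorem ruleGuard_of_ruleOf {t : ℕ} {p d : V} {k : Rule} (h : ruleOf (e.act t) p d = some k) :
    (e.conf t).RuleGuard p d k := by
  unfold ruleOf at h
  split at h
  · rename_i r hr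
    have := (e.act_enabled t p _ hr).2.2 d
    rw [h] at this
    exact this
  · cases h

/-- Without routing actions, a selected processor serves every destination with an enabled rule, so
destinations do not starve one another. -/
theorem not_ruleGuard_of_ruleOf {t : ℕ} {p d : V} (hs : ∀ l, ¬ A.guard p l (e.conf t).tab)
    (ha : e.act t p ≠ none) (h : ruleOf (e.act t) p d = none) (k : Rule) :
    ¬ (e.conf t).RuleGuard p d k := by
  rcases hact : e.act t p with _ | (l | r)
  · exact absurd hact ha
  · exact absurd (e.act_enabled t p _ hact) (hs l)
  · have hr : r d = none := by simpa only [ruleOf, hact] using h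
    have := (e.act_enabled t p _ hact).2.2 d
    rw [hr] at this
    exact this k

open Classical in
theorem enabled_of_ruleGuard {t : ℕ} {p d : V} (hs : ∀ l, ¬ A.guard p l (e.conf t).tab)
    {k : Rule} (h : (e.conf t).RuleGuard p d k) : (ssmfp A M Δ).Enabled (e.conf t) p := by
  refine ⟨.forward fun d' => if h' : ∃ k, (e.conf t).RuleGuard p d' k then some h'.choose else none,
    hs, ⟨d, ?_⟩, fun d' => ?_⟩
  · simp only [dif_pos (⟨k, h⟩ : ∃ k, (e.conf t).RuleGuard p d k)]
    exact Option.some_ne_none _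
  · by_cases h' : ∃ k, (e.conf t).RuleGuard p d' k
    · simp only [dif_pos h']
      exact h'.choose_spec
    · simp only [dif_neg h']
      exact fun k hk => h' ⟨k, hk⟩

/-- A message that has been copied by the next hop. -/
def Copied (e : Execution (ssmfp A M Δ)) (σ : ∀ p, A.State p) (d p : V) (m : M)
    (c : Fin (Δ + 1)) (s : ℕ) : Prop :=
  Carries ((e.conf s).bufE p d) m c ∧ (e.conf s).bufR (hopOf σ d p) d = some ⟨m, p, c⟩

namespace Settled

variable (h : Settled e τ σ)

include h

theorem not_guard {t : ℕ} (ht : τ ≤ t) (p : V) (l : A.Label) : ¬ A.guard p l (e.conf t).tab := by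
  rw [h.tab_eq t ht]
  exact h.silent p l

theorem hop_eq {t : ℕ} (ht : τ ≤ t) (p d : V) : (e.conf t).hop p d = hopOf σ d p := by
  rw [Vars.hop, h.tab_eq t ht]
  rfl

/-- If, as long as `Q` holds, `p` is enabled for `d`, and if every step preserves `Q` without an
action of `p` for `d` or achieves `Q'`, then `Q'` is achieved within one round. -/
theorem progress [Finite V] {t : ℕ} (ht : τ ≤ t) (p d : V) {Q Q' : ℕ → Prop} (hQ : Q t)
    (hen : ∀ s, τ ≤ s → Q s → ∃ k, (e.conf s).RuleGuard p d k)
    (hstep : ∀ s, τ ≤ s → Q s → (ruleOf (e.act s) p d = none ∧ Q (s + 1)) ∨ Q' (s + 1)) :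
    e.Within t 1 Q' := by
  by_contra hcon
  have hno : ∀ s, t ≤ s → s ≤ e.roundEnd t → ¬ Q' s := fun s hs hs' hq => hcon ⟨s, hs, hs', hq⟩
  have hall : ∀ s, t ≤ s → s ≤ e.roundEnd t → Q s := by
    intro s hs
    induction s, hs using Nat.le_induction with
    | base => exact fun _ => hQ
    | succ s hs ih =>
      intro hs'
      exact ((hstep s (by omega) (ih (by omega))).resolve_right (hno _ (by omega) hs')).2
  have henabled : ∀ s, t ≤ s → s ≤ e.roundEnd t → (ssmfp A M Δ).Enabled (e.conf s) p := by
    intro s hs hs'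
    obtain ⟨k, hk⟩ := hen s (by omega) (hall s hs hs')
    exact enabled_of_ruleGuard (h.not_guard (by omega) p) hk
  obtain ⟨k, hk, hk', hr⟩ := e.exists_resolved (henabled t le_rfl (e.lt_roundEnd t).le)
  rcases hr with hr | hr
  · obtain ⟨k', hg⟩ := hen k (by omega) (hall k hk hk'.le)
    have := (hstep k (by omega) (hall k hk hk'.le)).resolve_right (hno _ (by omega) hk')
    exact not_ruleGuard_of_ruleOf (h.not_guard (by omega) p) hr this.1 k' hg
  · exact hr.2.2 (henabled (k + 1) (by omega) hk')

theorem candidate_of_choice {t : ℕ} (ht : τ ≤ t) {p d s : V} (hc : (e.conf t).choice p d = some s)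
    (hs : s ≠ p) : G.Adj p s ∧ hopOf σ d s = p := by
  have hmem : s ∈ (e.conf t).queue p d := List.mem_of_head? hc
  rcases ((e.conf t).mem_queue p d s).1 hmem with ⟨ha, -, hh⟩ | ⟨rfl, -⟩
  · exact ⟨ha, (h.hop_eq ht s d).symm.trans hh⟩
  · exact absurd rfl hs

/-- What a processor may do to its buffers for `d` in one step. -/
theorem rule_cases {t : ℕ} (ht : τ ≤ t) (p d : V) :
    (ruleOf (e.act t) p d = none ∧ (e.conf (t + 1)).bufR p d = (e.conf t).bufR p d ∧
      (e.conf (t + 1)).bufE p d = (e.conf t).bufE p d) ∨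
    (ruleOf (e.act t) p d = some .R1 ∧ (e.conf t).bufR p d = none ∧
      (e.conf t).choice p d = some p ∧
      (∃ m, (e.conf (t + 1)).bufR p d = some ⟨m, p, 0⟩) ∧
      (e.conf (t + 1)).bufE p d = (e.conf t).bufE p d) ∨
    (ruleOf (e.act t) p d = some .R2 ∧ (e.conf t).bufE p d = none ∧
      ∃ m q c c', (e.conf t).bufR p d = some ⟨m, q, c⟩ ∧
        (q = p ∨ ¬ Carries ((e.conf t).bufE q d) m c) ∧
        (e.conf (t + 1)).bufR p d = none ∧ (e.conf (t + 1)).bufE p d = some ⟨m, p, c'⟩ ∧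
        ∀ s, G.Adj p s → ∀ μ, (e.conf t).bufR s d = some μ → μ.color ≠ c') ∨
    (ruleOf (e.act t) p d = some .R3 ∧ (e.conf t).bufR p d = none ∧
      (∃ s m q c, (e.conf t).choice p d = some s ∧ s ≠ p ∧ G.Adj p s ∧ hopOf σ d s = p ∧
        (e.conf t).bufE s d = some ⟨m, q, c⟩ ∧ (e.conf (t + 1)).bufR p d = some ⟨m, s, c⟩) ∧
      (e.conf (t + 1)).bufE p d = (e.conf t).bufE p d) ∨
    ((ruleOf (e.act t) p d = some .R4 ∨ ruleOf (e.act t) p d = some .R6) ∧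
      (e.conf t).bufE p d ≠ none ∧ (e.conf (t + 1)).bufR p d = (e.conf t).bufR p d ∧
      (e.conf (t + 1)).bufE p d = none) ∨
    (ruleOf (e.act t) p d = some .R5 ∧
      (∃ m q c, (e.conf t).bufR p d = some ⟨m, q, c⟩ ∧ q ≠ p ∧
        Carries ((e.conf t).bufE q d) m c ∧ hopOf σ d q ≠ p) ∧
      (e.conf (t + 1)).bufR p d = none ∧
      (e.conf (t + 1)).bufE p d = (e.conf t).bufE p d) := by
  have heff := (e.step t).2.1 p d
  have hguard := @ruleGuard_of_ruleOf V G A M Δ e t p d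
  rcases hρ : ruleOf (e.act t) p d with _ | k
  · rw [hρ] at heff
    exact Or.inl ⟨rfl, heff⟩
  · have hg := hguard hρ
    rw [hρ] at heff
    cases k with
    | R1 =>
      obtain ⟨⟨m, -, hm⟩, hE⟩ := heff
      exact Or.inr (Or.inl ⟨rfl, hg.2.1, hg.2.2, ⟨m, hm⟩, hE⟩)
    | R2 =>
      obtain ⟨hR, m, q, c, c', h1, h2, h3⟩ := heff
      obtain ⟨hE, m', q', c'', h4, h5⟩ := hg
      rw [h1] at h4
      cases h4
      exact Or.inr (Or.inr (Or.inl ⟨rfl, hE, m, q, c, c', h1, h5, hR, h2, h3⟩))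
    | R3 =>
      obtain ⟨⟨s, m, q, c, h1, h2, h3⟩, hE⟩ := heff
      obtain ⟨hR, s', h4, h5, -⟩ := hg
      rw [h1] at h4
      cases h4
      obtain ⟨h6, h7⟩ := h.candidate_of_choice ht h1 h5
      exact Or.inr (Or.inr (Or.inr (Or.inl ⟨rfl, hR, ⟨s, m, q, c, h1, h5, h6, h7, h2, h3⟩, hE⟩)))
    | R4 =>
      obtain ⟨hR, hE⟩ := heff
      obtain ⟨-, m, q, c, h1, -⟩ := hg
      exact Or.inr (Or.inr (Or.inr (Or.inr (Or.inl
        ⟨Or.inl rfl, by rw [h1]; exact Option.some_ne_none _, hR, hE⟩))))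
    | R5 =>
      obtain ⟨hR, hE⟩ := heff
      obtain ⟨m, q, c, h1, h2, h3, h4⟩ := hg
      rw [h.hop_eq ht] at h4
      exact Or.inr (Or.inr (Or.inr (Or.inr (Or.inr ⟨rfl, ⟨m, q, c, h1, h2, h3, h4⟩, hR, hE⟩))))
    | R6 =>
      obtain ⟨hR, hE⟩ := heff
      exact Or.inr (Or.inr (Or.inr (Or.inr (Or.inl ⟨Or.inr rfl, hg.2, hR, hE⟩))))

/-- A nonempty emission buffer keeps its content or is emptied. -/
theorem bufE_succ_of_some {t : ℕ} (ht : τ ≤ t) {p d : V} {μ : Message V M Δ}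
    (hE : (e.conf t).bufE p d = some μ) :
    (e.conf (t + 1)).bufE p d = some μ ∨ (e.conf (t + 1)).bufE p d = none := by
  rcases h.rule_cases ht p d with ⟨-, -, h1⟩ | ⟨-, -, -, -, h1⟩ | ⟨-, h1, -⟩ | ⟨-, -, -, h1⟩ |
    ⟨-, -, -, h1⟩ | ⟨-, -, -, h1⟩ <;> simp_all

/-- A nonempty reception buffer is emptied only by `R2` or `R5`, and it is never overwritten. -/
theorem bufR_succ_of_some {t : ℕ} (ht : τ ≤ t) {p d : V} {m : M} {q : V} {c : Fin (Δ + 1)}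
    (hR : (e.conf t).bufR p d = some ⟨m, q, c⟩) :
    (e.conf (t + 1)).bufR p d = some ⟨m, q, c⟩ ∨
    ((e.conf (t + 1)).bufR p d = none ∧
      ((q = p ∨ ¬ Carries ((e.conf t).bufE q d) m c) ∨
        (Carries ((e.conf t).bufE q d) m c ∧ hopOf σ d q ≠ p))) := by
  rcases h.rule_cases ht p d with ⟨-, h1, -⟩ | ⟨-, h1, -⟩ | ⟨-, -, m', q', c', c'', h1, h2, h3, -⟩ |
    ⟨-, h1, -⟩ | ⟨-, -, h1, -⟩ | ⟨-, ⟨m', q', c', h1, h2, h3, h4⟩, h5, -⟩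
  · exact Or.inl (h1.trans hR)
  · rw [hR] at h1; cases h1
  · rw [hR] at h1; cases h1
    exact Or.inr ⟨h3, Or.inl h2⟩
  · rw [hR] at h1; cases h1
  · exact Or.inl (h1.trans hR)
  · rw [hR] at h1; cases h1
    exact Or.inr ⟨h5, Or.inr ⟨h3, h4⟩⟩

/-- A message that did not come along the routing tables was already there before. -/
theorem bufR_of_succ_foreign {t : ℕ} (ht : τ ≤ t) {p d : V} {m : M} {q : V} {c : Fin (Δ + 1)}
    (hqp : q ≠ p) (hq : hopOf σ d q ≠ p)
    (hR : (e.conf (t + 1)).bufR p d = some ⟨m, q, c⟩) : (e.conf t).bufR p d = some ⟨m, q, c⟩ := by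
  rcases h.rule_cases ht p d with ⟨-, h1, -⟩ | ⟨-, -, -, ⟨m', h1⟩, -⟩ | ⟨-, -, m', q', c', c'', -, -, h1, -⟩ |
    ⟨-, -, ⟨s, m', q', c', -, -, -, h2, -, h1⟩, -⟩ | ⟨-, -, h1, -⟩ | ⟨-, -, h1, -⟩
  · exact h1.symm.trans hR
  · rw [hR] at h1; cases h1; exact absurd rfl hqp
  · rw [hR] at h1; cases h1
  · rw [hR] at h1; cases h1; exact absurd h2 hq
  · exact h1.symm.trans hR
  · rw [hR] at h1; cases h1

/-- A colour present in a reception buffer is not reused by the neighbours. -/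
theorem not_carries_succ {t : ℕ} (ht : τ ≤ t) {p q d : V} {m : M} {c : Fin (Δ + 1)}
    {q' : V} (hadj : G.Adj p q) (hR : (e.conf t).bufR p d = some ⟨m, q', c⟩)
    (hc : ¬ Carries ((e.conf t).bufE q d) m c) : ¬ Carries ((e.conf (t + 1)).bufE q d) m c := by
  rcases h.rule_cases ht q d with ⟨-, -, h1⟩ | ⟨-, -, -, -, h1⟩ |
    ⟨-, -, m', r, c', c'', -, -, -, h1, h2⟩ | ⟨-, -, -, h1⟩ | ⟨-, -, -, h1⟩ | ⟨-, -, -, h1⟩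
  · rwa [h1]
  · rwa [h1]
  · rw [h1]
    rintro ⟨q'', h3⟩
    cases h3
    exact h2 p hadj.symm _ hR rfl
  · rwa [h1]
  · rw [h1]
    rintro ⟨q'', h3⟩
    cases h3
  · rwa [h1]

/-! ### Clearing buffers in a bounded number of rounds -/

/-- If, as long as the emission buffer of `p` is not empty, `R4` or `R6` is enabled, then it is
emptied within three rounds. -/
theorem bufE_empties_of_guard [Finite V] {t : ℕ} (ht : τ ≤ t) {p d : V} {Q : ℕ → Prop} (hQ : Q t)
    (hne : ∀ s, τ ≤ s → Q s → (e.conf s).bufE p d ≠ none)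
    (hen : ∀ s, τ ≤ s → Q s → ∃ k, (e.conf s).RuleGuard p d k)
    (hstep : ∀ s, τ ≤ s → Q s → Q (s + 1) ∨ (e.conf (s + 1)).bufE p d = none) :
    e.Within t 3 fun s => (e.conf s).bufE p d = none := by
  -- The processor may prefer another rule to `R4` or `R6`, but only twice: `R5` empties its
  -- reception buffer, then `R1` or `R3` refills it with a fresh message. `R5` never applies to a
  -- fresh message, and `R2` is blocked by the full emission buffer. Hence one round for each of
  -- three stages.
  let Fresh : ℕ → Prop := fun s =>
    ∃ m q c, (e.conf s).bufR p d = some ⟨m, q, c⟩ ∧ (q = p ∨ hopOf σ d q = p)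
  have hA : ∀ t, τ ≤ t → Q t → Fresh t → e.Within t 1 fun s => (e.conf s).bufE p d = none := by
    intro t ht hQ hF
    refine h.progress ht p d (Q := fun s => Q s ∧ Fresh s) ⟨hQ, hF⟩
      (fun s hs hq => hen s hs hq.1) ?_
    rintro s hs ⟨hq, m, q, c, hR, hF⟩
    rcases hstep s hs hq with hq' | hq'
    swap
    · exact Or.inr hq'
    rcases h.rule_cases hs p d with ⟨h0, h1, -⟩ | ⟨-, h1, -⟩ | ⟨-, h1, -⟩ | ⟨-, h1, -⟩ |
      ⟨-, -, -, h1⟩ | ⟨-, ⟨m', q', c', h1, h2, h3, h4⟩, -, -⟩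
    · exact Or.inl ⟨h0, hq', m, q, c, h1.trans hR, hF⟩
    · rw [hR] at h1; cases h1
    · exact absurd h1 (hne s hs hq)
    · rw [hR] at h1; cases h1
    · exact Or.inr h1
    · rw [hR] at h1; cases h1
      exact absurd hF (by simp [h2, h4])
  have hB : ∀ t, τ ≤ t → Q t → (e.conf t).bufR p d = none →
      e.Within t 2 fun s => (e.conf s).bufE p d = none := by
    intro t ht hQ hR
    have h1 : e.Within t 1 fun s => (e.conf s).bufE p d = none ∨ (Q s ∧ Fresh s) := by
      refine h.progress ht p d (Q := fun s => Q s ∧ (e.conf s).bufR p d = none) ⟨hQ, hR⟩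
        (fun s hs hq => hen s hs hq.1) ?_
      rintro s hs ⟨hq, hR⟩
      rcases hstep s hs hq with hq' | hq'
      swap
      · exact Or.inr (Or.inl hq')
      rcases h.rule_cases hs p d with ⟨h0, h1, -⟩ | ⟨-, -, -, ⟨m, h1⟩, -⟩ | ⟨-, h1, -⟩ |
        ⟨-, -, ⟨s', m, q, c, -, -, -, h2, -, h1⟩, -⟩ | ⟨-, -, -, h1⟩ | ⟨-, ⟨m', q', c', h1, -⟩, -, -⟩
      · exact Or.inl ⟨h0, hq', h1.trans hR⟩
      · exact Or.inr (Or.inr ⟨hq', m, p, 0, h1, Or.inl rfl⟩)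
      · exact absurd h1 (hne s hs hq)
      · exact Or.inr (Or.inr ⟨hq', m, s', c, h1, Or.inr h2⟩)
      · exact Or.inr (Or.inl h1)
      · rw [hR] at h1; cases h1
    refine h1.trans (K' := 1) fun s hs hq => ?_
    rcases hq with hq | ⟨hq, hF⟩
    · exact .of_now _ hq
    · exact hA s (ht.trans hs) hq hF
  have h1 : e.Within t 1 fun s => (e.conf s).bufE p d = none ∨
      (Q s ∧ ((e.conf s).bufR p d = none ∨ Fresh s)) := by
    by_cases hR : (e.conf t).bufR p d = none ∨ Fresh t
    · exact .of_now _ (Or.inr ⟨hQ, hR⟩)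
    refine h.progress ht p d (Q := fun s => Q s ∧ (e.conf s).bufR p d ≠ none)
      ⟨hQ, fun h' => hR (Or.inl h')⟩ (fun s hs hq => hen s hs hq.1) ?_
    rintro s hs ⟨hq, hR⟩
    rcases hstep s hs hq with hq' | hq'
    swap
    · exact Or.inr (Or.inl hq')
    rcases h.rule_cases hs p d with ⟨h0, h1, -⟩ | ⟨-, h1, -⟩ | ⟨-, h1, -⟩ |
      ⟨-, h1, -⟩ | ⟨-, -, -, h1⟩ | ⟨-, -, h1, -⟩
    · exact Or.inl ⟨h0, hq', by rwa [h1]⟩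
    · exact absurd h1 hR
    · exact absurd h1 (hne s hs hq)
    · exact absurd h1 hR
    · exact Or.inr (Or.inl h1)
    · exact Or.inr (Or.inr ⟨hq', Or.inl h1⟩)
  refine h1.trans (K' := 2) fun s hs hq => ?_
  rcases hq with hq | ⟨hq, hR | hF⟩
  · exact .of_now _ hq
  · exact hB s (ht.trans hs) hq hR
  · exact (hA s (ht.trans hs) hq hF).mono (by omega) fun _ _ h => h

/-- The destination consumes its messages. -/
theorem bufE_dest_empties [Finite V] {t : ℕ} (ht : τ ≤ t) (d : V) :
    e.Within t 3 fun s => (e.conf s).bufE d d = none := by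
  by_cases hE : (e.conf t).bufE d d = none
  · exact .of_now _ hE
  exact h.bufE_empties_of_guard ht (Q := fun s => (e.conf s).bufE d d ≠ none) hE
    (fun _ _ hq => hq) (fun s _ hq => ⟨.R6, rfl, hq⟩)
    fun s _ _ => (em ((e.conf (s + 1)).bufE d d = none)).symm

/-- While the original stays in the emission buffer, the copy is locked: `R2` is blocked by the
original, and `R5` by the fact that the copy sits at the next hop. -/
theorem copied_succ {t : ℕ} (ht : τ ≤ t) {d p : V} (hp : p ≠ d) {m : M} {c : Fin (Δ + 1)}
    (hC : Copied e σ d p m c t) :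
    Copied e σ d p m c (t + 1) ∨ (e.conf (t + 1)).bufE p d = none := by
  obtain ⟨⟨q, hE⟩, hR⟩ := hC
  rcases h.bufE_succ_of_some ht hE with hE' | hE'
  swap
  · exact Or.inr hE'
  refine Or.inl ⟨⟨q, hE'⟩, ?_⟩
  rcases h.bufR_succ_of_some ht hR with hR' | ⟨-, (h1 | h1) | ⟨-, h1⟩⟩
  · exact hR'
  · exact absurd h1 (hopOf_adj σ hp).ne
  · exact absurd ⟨q, hE⟩ h1
  · exact absurd rfl h1

/-- The duplicates of a copied message are erased within two rounds. -/
theorem duplicate_erased [Finite V] {t : ℕ} (ht : τ ≤ t) {d p r : V} (hp : p ≠ d) {m : M}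
    {c : Fin (Δ + 1)} (hC : Copied e σ d p m c t) (hr : G.Adj p r) (hrp : r ≠ hopOf σ d p) :
    e.Within t 2 fun s => (e.conf s).bufE p d = none ∨ (e.conf s).bufR r d ≠ some ⟨m, p, c⟩ := by
  by_cases hR : (e.conf t).bufR r d ≠ some ⟨m, p, c⟩
  · exact .of_now _ (Or.inr hR)
  have hR := not_not.1 hR
  have hen : ∀ s, τ ≤ s → Copied e σ d p m c s → (e.conf s).bufR r d = some ⟨m, p, c⟩ →
      ∃ k, (e.conf s).RuleGuard r d k := fun s hs hC hR =>
    ⟨.R5, m, p, c, hR, hr.ne, hC.1, by rw [h.hop_eq hs]; exact hrp.symm⟩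
  -- Processor `r` may execute `R4` or `R6` in place of `R5`, but only once: its emission buffer is
  -- then empty, and refilling it by `R2` would itself remove the duplicate.
  have h1 : e.Within t 1 fun s =>
      ((e.conf s).bufE p d = none ∨ (e.conf s).bufR r d ≠ some ⟨m, p, c⟩) ∨
      (Copied e σ d p m c s ∧ (e.conf s).bufR r d = some ⟨m, p, c⟩ ∧
        (e.conf s).bufE r d = none) := by
    refine h.progress ht r d
      (Q := fun s => Copied e σ d p m c s ∧ (e.conf s).bufR r d = some ⟨m, p, c⟩) ⟨hC, hR⟩
      (fun s hs hq => hen s hs hq.1 hq.2) ?_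
    rintro s hs ⟨hC, hR⟩
    rcases h.copied_succ hs hp hC with hC' | hE
    swap
    · exact Or.inr (Or.inl (Or.inl hE))
    rcases h.rule_cases hs r d with ⟨h0, h1, -⟩ | ⟨-, h1, -⟩ | ⟨-, -, m', q', c', c'', -, -, h1, -⟩ |
      ⟨-, h1, -⟩ | ⟨-, -, h2, h1⟩ | ⟨-, -, h1, -⟩
    · exact Or.inl ⟨h0, hC', h1.trans hR⟩
    · rw [hR] at h1; cases h1
    · exact Or.inr (Or.inl (Or.inr (by rw [h1]; exact Option.some_ne_none _ |>.symm)))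
    · rw [hR] at h1; cases h1
    · exact Or.inr (Or.inr ⟨hC', h2.trans hR, h1⟩)
    · exact Or.inr (Or.inl (Or.inr (by rw [h1]; exact Option.some_ne_none _ |>.symm)))
  refine h1.trans (K' := 1) fun t' ht' hq => ?_
  rcases hq with hq | ⟨hC, hR, hE⟩
  · exact .of_now _ hq
  refine h.progress (ht.trans ht') r d
    (Q := fun s => Copied e σ d p m c s ∧ (e.conf s).bufR r d = some ⟨m, p, c⟩ ∧
      (e.conf s).bufE r d = none) ⟨hC, hR, hE⟩
    (fun s hs hq => hen s hs hq.1 hq.2.1) ?_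
  rintro s hs ⟨hC, hR, hE⟩
  rcases h.copied_succ hs hp hC with hC' | hE'
  swap
  · exact Or.inr (Or.inl hE')
  rcases h.rule_cases hs r d with ⟨h0, h1, h2⟩ | ⟨-, h1, -⟩ | ⟨-, -, m', q', c', c'', -, -, h1, -⟩ |
    ⟨-, h1, -⟩ | ⟨-, h1, -, -⟩ | ⟨-, -, h1, -⟩
  · exact Or.inl ⟨h0, hC', h1.trans hR, h2.trans hE⟩
  · rw [hR] at h1; cases h1
  · exact Or.inr (Or.inr (by rw [h1]; exact Option.some_ne_none _ |>.symm))
  · rw [hR] at h1; cases h1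
  · exact absurd hE h1
  · exact Or.inr (Or.inr (by rw [h1]; exact Option.some_ne_none _ |>.symm))

/-- Two rounds remove the duplicates at the other neighbours; then `R4` is enabled until the buffer
is emptied, which takes three more. Neither count depends on the distance to the destination. -/
theorem copied_erased [Finite V] {t : ℕ} (ht : τ ≤ t) {d p : V} (hp : p ≠ d) {m : M}
    {c : Fin (Δ + 1)} (hC : Copied e σ d p m c t) :
    e.Within t 5 fun s => (e.conf s).bufE p d = none := by
  by_cases hE : ∃ s, t ≤ s ∧ s ≤ e.rounds t 2 ∧ (e.conf s).bufE p d = none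
  · exact Execution.Within.mono (K := 2) hE (by omega) fun _ _ h => h
  have hE : ∀ s, t ≤ s → s ≤ e.rounds t 2 → (e.conf s).bufE p d ≠ none :=
    fun s hs hs' h => hE ⟨s, hs, hs', h⟩
  have hall : ∀ s, t ≤ s → s ≤ e.rounds t 2 → Copied e σ d p m c s := by
    intro s hs
    induction s, hs using Nat.le_induction with
    | base => exact fun _ => hC
    | succ s hs ih =>
      exact fun hs' => (h.copied_succ (ht.trans hs) hp (ih (by omega))).resolve_right
        (hE _ (by omega) hs')
  have hle := e.le_rounds t 2
  -- Under frozen tables only the next hop of `p` copies from `p`, so an erased duplicate cannot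
  -- come back.
  have hstay : ∀ r, G.Adj p r → r ≠ hopOf σ d p → ∀ s s', τ ≤ s → s ≤ s' →
      (e.conf s).bufR r d ≠ some ⟨m, p, c⟩ → (e.conf s').bufR r d ≠ some ⟨m, p, c⟩ := by
    intro r hr hrp s s' hs hss hne
    induction s', hss using Nat.le_induction with
    | base => exact hne
    | succ s' hss ih => exact fun h' => ih (h.bufR_of_succ_foreign (hs.trans hss) hr.ne hrp.symm h')
  have hdup : ∀ r, G.Adj p r → r ≠ hopOf σ d p →
      (e.conf (e.rounds t 2)).bufR r d ≠ some ⟨m, p, c⟩ := by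
    intro r hr hrp
    obtain ⟨s, hs, hs', hq⟩ := h.duplicate_erased ht hp hC hr hrp
    exact hstay r hr hrp s _ (ht.trans hs) hs' (hq.resolve_left (hE s hs hs'))
  have h2 : e.Within t 2 fun s => Copied e σ d p m c s ∧
      ∀ r, G.Adj p r → r ≠ hopOf σ d p → (e.conf s).bufR r d ≠ some ⟨m, p, c⟩ :=
    ⟨_, hle, le_rfl, hall _ hle le_rfl, hdup⟩
  refine h2.trans (K' := 3) fun s hs hq => ?_
  refine h.bufE_empties_of_guard (ht.trans hs) (Q := fun s => Copied e σ d p m c s ∧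
    ∀ r, G.Adj p r → r ≠ hopOf σ d p → (e.conf s).bufR r d ≠ some ⟨m, p, c⟩) hq ?_ ?_ ?_
  · rintro s - ⟨⟨⟨q, hE⟩, -⟩, -⟩
    rw [hE]
    exact Option.some_ne_none _
  · rintro s hs ⟨⟨⟨q, hE⟩, hR⟩, hr⟩
    refine ⟨.R4, hp, m, q, c, hE, ?_, ?_⟩ <;> rw [h.hop_eq hs]
    · exact hR
    · exact hr
  · rintro s hs ⟨hC, hr⟩
    exact (h.copied_succ hs hp hC).imp_left fun hC' =>
      ⟨hC', fun r hr' hrp => hstay r hr' hrp s _ hs (Nat.le_succ s) (hr r hr' hrp)⟩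

/-- If the emission buffer of `p` is emptied within `W` rounds, whenever it is full, then its
reception buffer is emptied within `W + 6` rounds. -/
theorem bufR_empties [Finite V] {p d : V} {W : ℕ}
    (hW : ∀ t, τ ≤ t → e.Within t W fun s => (e.conf s).bufE p d = none) {t : ℕ} (ht : τ ≤ t) :
    e.Within t (W + 6) fun s => (e.conf s).bufR p d = none := by
  rcases hR : (e.conf t).bufR p d with _ | ⟨m, q, c⟩
  · exact .of_now _ hR
  have hlast := (e.conf t).bufR_last p d _ hR
  simp only at hlast
  have hpersist : ∀ {t s}, τ ≤ t → t ≤ s → (e.conf t).bufR p d = some ⟨m, q, c⟩ →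
      (e.conf s).bufR p d = some ⟨m, q, c⟩ ∨
        ∃ r, t ≤ r ∧ r ≤ s ∧ (e.conf r).bufR p d = none := by
    intro t s ht hs hR
    induction s, hs using Nat.le_induction with
    | base => exact Or.inl hR
    | succ s hs ih =>
      rcases ih with ih | ⟨r, h1, h2, h3⟩
      · rcases h.bufR_succ_of_some (ht.trans hs) ih with h1 | ⟨h1, -⟩
        · exact Or.inl h1
        · exact Or.inr ⟨s + 1, by omega, le_rfl, h1⟩
      · exact Or.inr ⟨r, h1, by omega, h3⟩
  have hlift : ∀ {t K} {Q : ℕ → Prop}, τ ≤ t → (e.conf t).bufR p d = some ⟨m, q, c⟩ →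
      e.Within t K Q → e.Within t K fun s => (e.conf s).bufR p d = none ∨
        (Q s ∧ (e.conf s).bufR p d = some ⟨m, q, c⟩) := by
    rintro t K Q ht hR ⟨s, hs, hs', hq⟩
    rcases hpersist ht hs hR with h1 | ⟨r, h1, h2, h3⟩
    · exact ⟨s, hs, hs', Or.inr ⟨hq, h1⟩⟩
    · exact ⟨r, h1, h2.trans hs', Or.inl h3⟩
  -- With an empty emission buffer at `p`, this is exactly what enables `R2` or `R5` for the stored
  -- message.
  let Free : ℕ → Prop := fun s => q = p ∨ ¬ (Carries ((e.conf s).bufE q d) m c) ∨ hopOf σ d q ≠ p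
  have hfree : ∀ t, τ ≤ t → (e.conf t).bufR p d = some ⟨m, q, c⟩ → e.Within t 5 Free := by
    intro t ht hR
    by_cases hF : Free t
    · exact .of_now _ hF
    simp only [Free, not_or, not_not] at hF
    obtain ⟨hqp, hca, hh⟩ := hF
    -- The obstacle is the original still held by `q`. If `q` is the destination it is consumed;
    -- otherwise the message is `Copied` and erased in constant time, so no bound for `q` is needed
    -- from the induction on distances.
    have hempty : e.Within t 5 fun s => (e.conf s).bufE q d = none := by
      rcases eq_or_ne q d with rfl | hqd
      · exact (h.bufE_dest_empties ht q).mono (by omega) fun _ _ h => h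
      · exact h.copied_erased ht hqd (m := m) (c := c) ⟨hca, by rw [hh]; exact hR⟩
    refine hempty.mono le_rfl fun s _ hs => Or.inr (Or.inl ?_)
    rintro ⟨q', h1⟩
    rw [hs] at h1
    cases h1
  have hlast1 : ∀ t, τ ≤ t → (e.conf t).bufE p d = none → (e.conf t).bufR p d = some ⟨m, q, c⟩ →
      Free t → e.Within t 1 fun s => (e.conf s).bufR p d = none := by
    intro t ht hE hR hF
    refine h.progress ht p d (Q := fun s => (e.conf s).bufE p d = none ∧
      (e.conf s).bufR p d = some ⟨m, q, c⟩ ∧ Free s) ⟨hE, hR, hF⟩ ?_ ?_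
    · rintro s hs ⟨hE, hR, hF⟩
      by_cases h2 : q = p ∨ ¬ Carries ((e.conf s).bufE q d) m c
      · exact ⟨.R2, hE, m, q, c, hR, h2⟩
      · simp only [not_or, not_not] at h2
        refine ⟨.R5, m, q, c, hR, h2.1, h2.2, ?_⟩
        rw [h.hop_eq hs]
        exact (hF.resolve_left h2.1).resolve_left (not_not.2 h2.2)
    · rintro s hs ⟨hE, hR, hF⟩
      rcases h.rule_cases hs p d with ⟨h0, h1, h2⟩ | ⟨-, h1, -⟩ |
        ⟨-, -, m', q', c', c'', -, -, h1, -⟩ | ⟨-, h1, -⟩ | ⟨-, h1, -, -⟩ | ⟨-, -, h1, -⟩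
      · refine Or.inl ⟨h0, h2.trans hE, h1.trans hR, ?_⟩
        rcases hF with hF | hF | hF
        · exact Or.inl hF
        · rcases hlast with hq | hq
          · exact Or.inl hq
          -- Here the colours matter: `q` cannot choose the colour `c` while its neighbour `p` holds
          -- it in a reception buffer.
          · exact Or.inr (Or.inl (h.not_carries_succ hs hq hR hF))
        · exact Or.inr (Or.inr hF)
      · rw [hR] at h1; cases h1
      · exact Or.inr h1
      · rw [hR] at h1; cases h1
      · exact absurd hE h1
      · exact Or.inr h1
  -- While waiting for `Free`, the emission buffer of `p` stays empty: only `R2` fills it, and `R2`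
  -- empties the reception buffer.
  have hfreeE : ∀ t, τ ≤ t → (e.conf t).bufE p d = none →
      (e.conf t).bufR p d = some ⟨m, q, c⟩ → e.Within t 5 fun s =>
        (e.conf s).bufR p d = none ∨
        ((e.conf s).bufE p d = none ∧ Free s ∧ (e.conf s).bufR p d = some ⟨m, q, c⟩) := by
    intro t ht hE hR
    obtain ⟨s, hs, hs', hq⟩ := hfree t ht hR
    have : ((e.conf s).bufE p d = none ∧ (e.conf s).bufR p d = some ⟨m, q, c⟩) ∨
        ∃ r, t ≤ r ∧ r ≤ s ∧ (e.conf r).bufR p d = none := by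
      clear hs' hq
      induction s, hs using Nat.le_induction with
      | base => exact Or.inl ⟨hE, hR⟩
      | succ s hs ih =>
        rcases ih with ⟨hE, hR⟩ | ⟨r, h1, h2, h3⟩
        · rcases h.rule_cases (ht.trans hs) p d with ⟨-, h1, h2⟩ | ⟨-, h1, -⟩ |
            ⟨-, -, m', q', c', c'', -, -, h1, -⟩ | ⟨-, h1, -⟩ | ⟨-, h1, -, -⟩ | ⟨-, -, h1, -⟩
          · exact Or.inl ⟨h2.trans hE, h1.trans hR⟩
          · rw [hR] at h1; cases h1
          · exact Or.inr ⟨s + 1, by omega, le_rfl, h1⟩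
          · rw [hR] at h1; cases h1
          · exact absurd hE h1
          · exact Or.inr ⟨s + 1, by omega, le_rfl, h1⟩
        · exact Or.inr ⟨r, h1, by omega, h3⟩
    rcases this with ⟨h1, h2⟩ | ⟨r, h1, h2, h3⟩
    · exact ⟨s, hs, hs', Or.inr ⟨h1, hq, h2⟩⟩
    · exact ⟨r, h1, h2.trans hs', Or.inl h3⟩
  refine (hlift ht hR (hW t ht)).trans (K' := 6) fun t1 ht1 hq => ?_
  rcases hq with hq | ⟨hE, hR⟩
  · exact .of_now _ hq
  refine (hfreeE t1 (ht.trans ht1) hE hR).trans (K' := 1) fun t2 ht2 hq => ?_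
  rcases hq with hq | ⟨hE, hF, hR⟩
  · exact .of_now _ hq
  · exact hlast1 t2 ((ht.trans ht1).trans ht2) hE hR hF

end Settled

end Forwarding

/-! ### Fairness of the queues -/

section Queues

variable {V : Type u} {G : SimpleGraph V} {A : RoutingAlgorithm.{u, w, x} G} {M : Type v} {Δ : ℕ}
  {e : Execution (ssmfp A M Δ)} {τ : ℕ} {σ : ∀ p, A.State p}

/-- Fewer than `n` processors precede `s` in the queue for `bufR p d`. -/
def QueuedBefore (γ : Vars A M Δ) (p d s : V) (n : ℕ) : Prop :=
  ∃ l₁ l₂, γ.queue p d = l₁ ++ s :: l₂ ∧ l₁.length < n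

/-- In step `t`, the message of `s` enters `bufR p d`. -/
def Served (e : Execution (ssmfp A M Δ)) (p d s : V) (t : ℕ) : Prop :=
  (ruleOf (e.act t) p d = some .R1 ∨ ruleOf (e.act t) p d = some .R3) ∧
    (e.conf t).choice p d = some s

theorem queuedBefore_of_candidate {γ : Config A M Δ} {p d s : V} {n : ℕ}
    (hs : γ.Candidate p d s) (hn : (γ.queue p d).length ≤ n) : QueuedBefore γ.toVars p d s n := by
  obtain ⟨l₁, l₂, hl⟩ := List.append_of_mem ((γ.mem_queue p d s).2 hs)
  refine ⟨l₁, l₂, hl, ?_⟩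
  rw [hl, List.length_append, List.length_cons] at hn
  omega

theorem QueuedBefore.candidate {γ : Config A M Δ} {p d s : V} {n : ℕ}
    (h : QueuedBefore γ.toVars p d s n) : γ.Candidate p d s := by
  obtain ⟨l₁, l₂, hl, -⟩ := h
  exact (γ.mem_queue p d s).1 (by rw [hl]; simp)

/-- Filtering keeps the order and newcomers join at the end, so nobody overtakes `s`; serving
another processor removes the head, which stands before `s`. -/
theorem QueuedBefore.succ {t : ℕ} {p d s : V} {n : ℕ}
    (hq : QueuedBefore (e.conf t).toVars p d s (n + 1)) (hc : (e.conf (t + 1)).Candidate p d s)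
    (hs : ¬ Served e p d s t) :
    QueuedBefore (e.conf (t + 1)).toVars p d s (n + 1) ∧
      (ruleOf (e.act t) p d = some .R1 ∨ ruleOf (e.act t) p d = some .R3 →
        QueuedBefore (e.conf (t + 1)).toVars p d s n) := by
  classical
  obtain ⟨l₁, l₂, hl, hn⟩ := hq
  obtain ⟨new, hnew⟩ := (e.step t).2.2.2 p d
  have key : ∀ {l₁ : List V} {n}, l₁.length < n → (e.conf (t + 1)).queue p d =
      (l₁ ++ s :: l₂).filter (fun s => decide ((e.conf (t + 1)).Candidate p d s)) ++ new →
      QueuedBefore (e.conf (t + 1)).toVars p d s n := by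
    intro l₁ n hn heq
    refine ⟨l₁.filter fun s => decide ((e.conf (t + 1)).Candidate p d s),
      l₂.filter (fun s => decide ((e.conf (t + 1)).Candidate p d s)) ++ new, ?_, (List.length_filter_le _ _).trans_lt hn⟩
    rw [heq, List.filter_append, List.filter_cons_of_pos (by simpa using hc)]
    simp
  split_ifs at hnew with hr
  · rw [hl] at hnew
    rcases l₁ with _ | ⟨z, l₁⟩
    · refine absurd ⟨hr, ?_⟩ hs
      rw [Vars.choice, hl]
      rfl
    · simp only [List.length_cons] at hn
      have h1 : l₁.length < n := by omega
      exact ⟨key (by omega) hnew, fun _ => key h1 hnew⟩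
  · rw [hl] at hnew
    exact ⟨key hn hnew, fun h => absurd h hr⟩

theorem exists_guard_of_queued {γ : Config A M Δ} {p d s : V} {n : ℕ}
    (h : QueuedBefore γ.toVars p d s n) (hR : γ.bufR p d = none) : ∃ k, γ.RuleGuard p d k := by
  have hne : ∃ z, γ.choice p d = some z := by
    obtain ⟨l₁, l₂, hl, -⟩ := h
    rw [Vars.choice, hl]
    cases l₁ <;> exact ⟨_, rfl⟩
  obtain ⟨z, hz⟩ := hne
  have hc := (γ.mem_queue p d z).1 (List.mem_of_head? hz)
  by_cases hzp : z = p
  · subst hzp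
    rcases hc with ⟨ha, -⟩ | ⟨-, hr⟩
    · exact absurd rfl ha.ne
    · exact ⟨.R1, hr, hR, hz⟩
  · rcases hc with ⟨-, hE, -⟩ | ⟨h', -⟩
    · exact ⟨.R3, hR, z, hz, hzp, hE⟩
    · exact absurd h' hzp

/-- If the reception buffer of `p` is emptied within `B` rounds, whenever it is full, then a
candidate that stays one until its message enters this buffer waits for at most `B + 2` rounds for
each place of the queue. -/
theorem Settled.within_of_queued [Finite V] (h : Settled e τ σ) {p d s : V} {B : ℕ}
    (hB : ∀ t, τ ≤ t → e.Within t B fun r => (e.conf r).bufR p d = none) {Goal : ℕ → Prop}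
    (hG : ∀ t, τ ≤ t → (e.conf t).Candidate p d s →
      Goal (t + 1) ∨ ((e.conf (t + 1)).Candidate p d s ∧ ¬ Served e p d s t)) (n : ℕ) :
    ∀ t, τ ≤ t → QueuedBefore (e.conf t).toVars p d s n → e.Within t (n * (B + 2)) Goal := by
  induction n with
  | zero => exact fun t _ hq => by obtain ⟨_, _, _, hlt⟩ := hq; omega
  | succ n ih =>
    intro t ht hq
    let Pos : ℕ → Prop := fun r => QueuedBefore (e.conf r).toVars p d s (n + 1)
    have hpos : ∀ r, τ ≤ r → Pos r → Goal (r + 1) ∨ (Pos (r + 1) ∧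
        (ruleOf (e.act r) p d = some .R1 ∨ ruleOf (e.act r) p d = some .R3 →
          QueuedBefore (e.conf (r + 1)).toVars p d s n)) := by
      intro r hr hp
      exact (hG r hr hp.candidate).imp_right fun hc => hp.succ hc.1 hc.2
    have h1 : e.Within t B fun r => Goal r ∨ (Pos r ∧ (e.conf r).bufR p d = none) := by
      obtain ⟨r, hr, hr', hR⟩ := hB t ht
      have : Pos r ∨ ∃ r', t ≤ r' ∧ r' ≤ r ∧ Goal r' := by
        clear hr' hR
        induction r, hr using Nat.le_induction with
        | base => exact Or.inl hq
        | succ r hr ihr =>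
          rcases ihr with hp | ⟨r', h1, h2, h3⟩
          · rcases hpos r (ht.trans hr) hp with hg | hp'
            · exact Or.inr ⟨r + 1, by omega, le_rfl, hg⟩
            · exact Or.inl hp'.1
          · exact Or.inr ⟨r', h1, by omega, h3⟩
      rcases this with hp | ⟨r', h1, h2, h3⟩
      · exact ⟨r, hr, hr', Or.inr ⟨hp, hR⟩⟩
      · exact ⟨r', h1, h2.trans hr', Or.inl h3⟩
    let Next : ℕ → Prop := fun r => Goal r ∨ QueuedBefore (e.conf r).toVars p d s n
    have h2 : ∀ t, τ ≤ t → Pos t → (e.conf t).bufR p d = none → (e.conf t).bufE p d = none →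
        e.Within t 1 Next := by
      intro t ht hp hR hE
      refine h.progress ht p d (Q := fun r => Pos r ∧ (e.conf r).bufR p d = none ∧
        (e.conf r).bufE p d = none) ⟨hp, hR, hE⟩
        (fun r _ hq => exists_guard_of_queued hq.1 hq.2.1) ?_
      rintro r hr ⟨hp, hR, hE⟩
      rcases hpos r hr hp with hg | ⟨hp', hnext⟩
      · exact Or.inr (Or.inl hg)
      rcases h.rule_cases hr p d with ⟨h0, h1, h2⟩ | ⟨h0, -⟩ |
        ⟨-, -, m', q', c', c'', h1, -⟩ | ⟨h0, -⟩ | ⟨-, h1, -, -⟩ | ⟨-, ⟨m', q', c', h1, -⟩, -⟩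
      · exact Or.inl ⟨h0, hp', h1.trans hR, h2.trans hE⟩
      · exact Or.inr (Or.inr (hnext (Or.inl h0)))
      · rw [hR] at h1; cases h1
      · exact Or.inr (Or.inr (hnext (Or.inr h0)))
      · exact absurd hE h1
      · rw [hR] at h1; cases h1
    -- One extra round, since `p` may spend its turn on `R4` or `R6`. This cannot recur while the
    -- reception buffer is empty, because refilling the emission buffer requires `R2`.
    have h3 : ∀ t, τ ≤ t → Pos t → (e.conf t).bufR p d = none → e.Within t (1 + 1) Next := by
      intro t ht hp hR
      have h4 : e.Within t 1 fun r => Next r ∨ (Pos r ∧ (e.conf r).bufR p d = none ∧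
          (e.conf r).bufE p d = none) := by
        refine h.progress ht p d (Q := fun r => Pos r ∧ (e.conf r).bufR p d = none) ⟨hp, hR⟩
          (fun r _ hq => exists_guard_of_queued hq.1 hq.2) ?_
        rintro r hr ⟨hp, hR⟩
        rcases hpos r hr hp with hg | ⟨hp', hnext⟩
        · exact Or.inr (Or.inl (Or.inl hg))
        rcases h.rule_cases hr p d with ⟨h0, h1, h2⟩ | ⟨h0, -⟩ |
          ⟨-, -, m', q', c', c'', h1, -⟩ | ⟨h0, -⟩ | ⟨-, -, h1, h2⟩ | ⟨-, ⟨m', q', c', h1, -⟩, -⟩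
        · exact Or.inl ⟨h0, hp', h1.trans hR⟩
        · exact Or.inr (Or.inl (Or.inr (hnext (Or.inl h0))))
        · rw [hR] at h1; cases h1
        · exact Or.inr (Or.inl (Or.inr (hnext (Or.inr h0))))
        · exact Or.inr (Or.inr ⟨hp', h1.trans hR, h2⟩)
        · rw [hR] at h1; cases h1
      refine h4.trans fun r hr hq => ?_
      rcases hq with hq | ⟨hp, hR, hE⟩
      · exact .of_now _ hq
      · exact h2 r (ht.trans hr) hp hR hE
    have h5 : e.Within t (B + 2) Next := h1.trans fun r hr hq => by
      rcases hq with hq | ⟨hp, hR⟩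
      · exact .of_now _ (Or.inl hq)
      · exact h3 r (ht.trans hr) hp hR
    rw [Nat.succ_mul, Nat.add_comm]
    refine h5.trans fun r hr hq => ?_
    rcases hq with hq | hq
    · exact .of_now _ hq
    · exact ih r (ht.trans hr) hq

theorem length_queue_le (γ : Config A M Δ) (p d : V) (S : Finset V)
    (hS : ∀ s, γ.Candidate p d s → s ∈ S) : (γ.queue p d).length ≤ S.card := by
  classical
  rw [← List.toFinset_card_of_nodup (γ.queue_nodup p d)]
  refine Finset.card_le_card fun s hs => hS s ?_
  exact (γ.mem_queue p d s).1 (List.mem_toFinset.1 hs)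

theorem req_succ {t : ℕ} {p : V} (hr : Requests e t p)
    (hn : ¬ Emits e t p) : (e.conf (t + 1)).req p = (e.conf t).req p :=
  (e.step t).2.2.1 p hr fun d hd => hn ⟨d, hd⟩

theorem ne_of_dist_pos {p d : V} (hp : 1 ≤ G.dist p d) : p ≠ d := by
  rintro rfl
  rw [SimpleGraph.dist_self] at hp
  omega

end Queues

/-! ### Bounds on the waiting times -/

section Bounds

variable {V : Type u} [Fintype V] {G : SimpleGraph V} [DecidableRel G.Adj]
  {A : RoutingAlgorithm.{u, w, x} G} {M : Type v}

theorem length_queue_le_maxDegree_succ {Δ : ℕ} (γ : Config A M Δ) (p d : V) :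
    (γ.queue p d).length ≤ G.maxDegree + 1 := by
  classical
  refine (length_queue_le γ p d (insert p (G.neighborFinset p)) fun s hs => ?_).trans
    ((Finset.card_insert_le _ _).trans ?_)
  · rcases hs with ⟨ha, -⟩ | ⟨rfl, -⟩
    · exact Finset.mem_insert_of_mem ((G.mem_neighborFinset p s).2 ha)
    · exact Finset.mem_insert_self _ _
  · rw [G.card_neighborFinset_eq_degree]
    exact Nat.succ_le_succ (G.degree_le_maxDegree p)

/-! ### Growth of the bounds with the distance to the destination -/

/-- Rounds within which an emission buffer at distance `k` from the destination is emptied, in a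
network of maximal degree `Δ`. -/
def emptyBound (Δ : ℕ) : ℕ → ℕ
  | 0 => 3
  | k + 1 => (if k ≤ 1 then Δ + 1 else Δ) * (emptyBound Δ k + 8) + 5

/-- The shift 21 absorbs the additive constants: for `Δ ≥ 2`, `Δ * (w + 8) + 5 + 21 ≤ Δ * (w + 21)`,
with equality at `Δ = 2`. The factor 96 comes from `k = 2`, where the left side is `11 * Δ ^ 2 + 35
* Δ + 50`. -/
theorem emptyBound_le {Δ k : ℕ} (h1 : 1 ≤ k → 1 ≤ Δ) (h2 : 2 ≤ k → 2 ≤ Δ) :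
    emptyBound Δ k + 21 ≤ 96 * Δ ^ k := by
  induction k with
  | zero => simp [emptyBound]
  | succ k ih =>
    have hΔ := h1 (by omega)
    rcases k with _ | _ | k
    · simp only [emptyBound, zero_le, if_true, zero_add, pow_one]
      omega
    · simp only [emptyBound, zero_le, if_true, zero_add, le_refl]
      have : Δ ≤ Δ * Δ := Nat.le_mul_self Δ
      rw [show Δ ^ (1 + 1) = Δ * Δ by ring]
      nlinarith
    · have hΔ2 := h2 (by omega)
      have := ih (fun _ => hΔ) (fun _ => hΔ2)
      rw [emptyBound, if_neg (by omega), pow_succ]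
      set w := emptyBound Δ (k + 1 + 1)
      nlinarith

theorem one_le_maxDegree (σ : ∀ p, A.State p) {p d : V} (hp : 1 ≤ G.dist p d) :
    1 ≤ G.maxDegree := by
  refine le_trans ?_ (G.degree_le_maxDegree p)
  rw [Nat.succ_le_iff, G.degree_pos_iff_exists_adj]
  exact ⟨_, hopOf_adj σ (ne_of_dist_pos hp)⟩

variable {e : Execution (ssmfp A M G.maxDegree)} {τ : ℕ} {σ : ∀ p, A.State p}

namespace Settled

variable (h : Settled e τ σ)

include h

theorem dist_hopOf {p d : V} (hp : p ≠ d) : G.dist (hopOf σ d p) d + 1 = G.dist p d :=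
  h.correct p d hp

theorem hopOf_hopOf_ne {p d : V} (hp : 2 ≤ G.dist p d) : hopOf σ d (hopOf σ d p) ≠ p := by
  intro heq
  have h1 := h.dist_hopOf (ne_of_dist_pos (by omega : 1 ≤ G.dist p d))
  have h2 := h.dist_hopOf (ne_of_dist_pos (by omega : 1 ≤ G.dist (hopOf σ d p) d))
  rw [heq] at h2
  omega

/-- The next hop of `p` has two distinct neighbours, `p` and its own next hop. -/
theorem two_le_maxDegree {p d : V} (hp : 2 ≤ G.dist p d) : 2 ≤ G.maxDegree := by
  classical
  have hpd : p ≠ d := ne_of_dist_pos (G := G) (by omega)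
  have h1 := h.dist_hopOf hpd
  refine le_trans ?_ (G.degree_le_maxDegree (hopOf σ d p))
  rw [← G.card_neighborFinset_eq_degree, ← Finset.card_pair (h.hopOf_hopOf_ne hp)]
  refine Finset.card_le_card fun s hs => ?_
  rw [G.mem_neighborFinset]
  rcases Finset.mem_insert.1 hs with rfl | hs
  · exact hopOf_adj σ (ne_of_dist_pos (G := G) (by omega))
  · rw [Finset.mem_singleton.1 hs]
    exact (hopOf_adj σ hpd).symm

/-- The next hop of `p` does not route back to `p`, so `p` takes its place in the count. Distance 2
is needed: at distance 1 the next hop is `d`, whose entry for itself is arbitrary and may point to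
`p`. -/
theorem length_queue_le_maxDegree {t : ℕ} (ht : τ ≤ t) {p d : V} (hp : 2 ≤ G.dist p d) :
    ((e.conf t).queue p d).length ≤ G.maxDegree := by
  classical
  refine (length_queue_le _ p d (insert p ((G.neighborFinset p).erase (hopOf σ d p)))
    fun s hs => ?_).trans ((Finset.card_insert_le _ _).trans ?_)
  · rcases hs with ⟨ha, -, hh⟩ | ⟨rfl, -⟩
    · refine Finset.mem_insert_of_mem (Finset.mem_erase.2 ⟨?_, (G.mem_neighborFinset p s).2 ha⟩)
      rintro rfl
      rw [h.hop_eq ht] at hh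
      exact h.hopOf_hopOf_ne hp hh
    · exact Finset.mem_insert_self _ _
  · have hmem : hopOf σ d p ∈ G.neighborFinset p :=
      (G.mem_neighborFinset _ _).2 (hopOf_adj σ (ne_of_dist_pos (G := G) (by omega)))
    rw [Finset.card_erase_add_one hmem, G.card_neighborFinset_eq_degree]
    exact G.degree_le_maxDegree p

/-- A neighbour other than `d` routing through `p` would lie at distance `D + 1` from `d`. This
saves the last factor `Δ`. -/
theorem length_queue_le_two (hG : G.Connected) {t : ℕ} (ht : τ ≤ t) {p d : V}
    (hp : G.dist p d = G.diam) : ((e.conf t).queue p d).length ≤ 2 := by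
  classical
  have := hG.nonempty
  refine (length_queue_le _ p d {p, d} fun s hs => ?_).trans Finset.card_le_two
  rw [Finset.mem_insert, Finset.mem_singleton]
  rcases hs with ⟨-, -, hh⟩ | ⟨rfl, -⟩
  · right
    by_contra hsd
    have h1 := h.dist_hopOf hsd
    rw [h.hop_eq ht] at hh
    rw [hh] at h1
    have := SimpleGraph.dist_le_diam (SimpleGraph.connected_iff_ediam_ne_top.1 hG) (u := s) (v := d)
    omega
  · exact Or.inl rfl

/-- The buffer of `p` is a permanent candidate at its next hop `u` until it is emptied. Each place
in the queue of `u` costs the bound for `u`, plus 6 to empty `bufR u d` and 2 to serve; once the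
message is copied, 5 rounds erase the original. -/
theorem bufE_empties (hG : G.Connected) (d : V) (k : ℕ) : ∀ p, G.dist p d = k → ∀ t, τ ≤ t →
    e.Within t (emptyBound G.maxDegree k) fun s => (e.conf s).bufE p d = none := by
  induction k with
  | zero =>
    intro p hp t ht
    rw [hG.dist_eq_zero_iff] at hp
    subst hp
    exact h.bufE_dest_empties ht p
  | succ k ih =>
    intro p hp t ht
    have hpd : p ≠ d := ne_of_dist_pos (G := G) (by omega)
    have hdist := h.dist_hopOf hpd
    have hadj := hopOf_adj σ hpd
    set u := hopOf σ d p with hu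
    by_cases hE : (e.conf t).bufE p d = none
    · exact .of_now _ hE
    have hlen : ((e.conf t).queue u d).length ≤
        (if k ≤ 1 then G.maxDegree + 1 else G.maxDegree) := by
      split_ifs with hk
      · exact length_queue_le_maxDegree_succ _ u d
      · exact h.length_queue_le_maxDegree ht (by omega)
    have hcand : ∀ s, τ ≤ s → (e.conf s).bufE p d ≠ none → (e.conf s).Candidate u d p :=
      fun s hs hE => Or.inl ⟨hadj.symm, hE, h.hop_eq hs p d⟩
    have hB : ∀ t, τ ≤ t → e.Within t (emptyBound G.maxDegree k + 6)
        fun r => (e.conf r).bufR u d = none :=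
      fun t ht => h.bufR_empties (ih u (by omega)) ht
    refine (h.within_of_queued hB
      (Goal := fun s => (e.conf s).bufE p d = none ∨ ∃ m c, Copied e σ d p m c s) ?_ _ t ht
      (queuedBefore_of_candidate (hcand t ht hE) hlen)).trans (K' := 5) fun s hs hq => ?_
    · intro s hs hc
      have hE : (e.conf s).bufE p d ≠ none := by
        rcases hc with hc | hc
        · exact hc.2.1
        · exact absurd hc.1 hadj.ne
      obtain ⟨⟨m, q, c⟩, hm⟩ := Option.ne_none_iff_exists'.1 hE
      -- If `p` empties its buffer in the very step in which it is served, the goal holds already;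
      -- otherwise the copy and the original coexist.
      rcases h.bufE_succ_of_some hs hm with hE' | hE'
      swap
      · exact Or.inl (Or.inl hE')
      by_cases hserved : Served e u d p s
      · left; right
        refine ⟨m, c, ⟨q, hE'⟩, ?_⟩
        obtain ⟨hr, hch⟩ := hserved
        rcases h.rule_cases hs u d with ⟨h0, -⟩ | ⟨-, -, h1, -⟩ | ⟨h0, -⟩ |
          ⟨-, -, ⟨s', m', q', c', h1, -, -, -, h2, h3⟩, -⟩ | ⟨h0, -⟩ | ⟨h0, -⟩
        · simp [h0] at hr
        · rw [hch] at h1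
          exact absurd (Option.some.inj h1) hadj.ne
        · simp [h0] at hr
        · rw [hch] at h1; cases h1
          rw [hm] at h2; cases h2
          exact h3
        · rcases h0 with h0 | h0 <;> simp [h0] at hr
        · simp [h0] at hr
      · exact Or.inr ⟨hcand _ (by omega) (by rw [hE']; exact Option.some_ne_none _), hserved⟩
    · rcases hq with hq | ⟨m, c, hC⟩
      · exact .of_now _ hq
      · exact h.copied_erased (ht.trans hs) hpd hC

end Settled

/-- With settled tables, a waiting message is emitted within `192 * Δ ^ D` rounds. -/
theorem Settled.within_emits (hG : G.Connected) (h : Settled e τ σ) {p : V}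
    (hr : Requests e τ p) :
    e.Within τ (192 * G.maxDegree ^ G.diam) fun s => ∃ j, τ ≤ j ∧ j < s ∧ Emits e j p := by
  have hne := hG.nonempty
  obtain ⟨⟨m, d⟩, hm⟩ := Option.ne_none_iff_exists'.1 hr
  have hbound := emptyBound_le (Δ := G.maxDegree) (k := G.dist p d) (one_le_maxDegree σ)
    h.two_le_maxDegree
  have hdiam : G.dist p d ≤ G.diam :=
    SimpleGraph.dist_le_diam (SimpleGraph.connected_iff_ediam_ne_top.1 hG)
  have hlen : ∃ n, ((e.conf τ).queue p d).length ≤ n ∧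
      n * (emptyBound G.maxDegree (G.dist p d) + 6 + 2) ≤ 192 * G.maxDegree ^ G.diam := by
    -- At distance `D` the queue has length at most 2; at a smaller distance the factor `Δ + 1 ≤ 2 *
    -- Δ` fits because one exponent is still free.
    rcases hdiam.eq_or_lt with heq | hlt
    · refine ⟨2, h.length_queue_le_two hG le_rfl heq, ?_⟩
      rw [← heq]
      omega
    · refine ⟨_, length_queue_le_maxDegree_succ _ p d, ?_⟩
      have hΔ : 1 ≤ G.maxDegree := by
        by_contra h0
        have hΔ : G.maxDegree = 0 := by omega
        obtain ⟨a, b, hab⟩ := SimpleGraph.exists_dist_eq_diam (G := G)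
        have := one_le_maxDegree σ (p := a) (d := b) (by omega)
        omega
      calc (G.maxDegree + 1) * (emptyBound G.maxDegree (G.dist p d) + 6 + 2)
          ≤ (2 * G.maxDegree) * (96 * G.maxDegree ^ G.dist p d) :=
            Nat.mul_le_mul (by omega) (by omega)
        _ = 192 * G.maxDegree ^ (G.dist p d + 1) := by ring
        _ ≤ 192 * G.maxDegree ^ G.diam :=
            Nat.mul_le_mul_left _ (Nat.pow_le_pow_right hΔ hlt)
  obtain ⟨n, hn, hn'⟩ := hlen
  refine (h.within_of_queued (p := p) (d := d) (s := p)
    (fun t ht => h.bufR_empties (h.bufE_empties hG d _ p rfl) ht) ?_ n τ le_rfl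
    (queuedBefore_of_candidate (Or.inr ⟨rfl, m, hm⟩) hn)).mono hn' fun _ _ h => h
  intro t ht hc
  by_cases hem : Emits e t p
  · exact Or.inl ⟨t, ht, Nat.lt_succ_self t, hem⟩
  right
  rcases hc with ⟨ha, -⟩ | ⟨-, m', hm'⟩
  · exact absurd rfl ha.ne
  · refine ⟨Or.inr ⟨rfl, m', ?_⟩, ?_⟩
    · rw [← hm']
      exact req_succ (by rw [Requests, hm']; exact Option.some_ne_none _) hem
    · rintro ⟨h1 | h1, hch⟩
      · exact hem ⟨d, h1⟩
      -- `R3` never serves the processor itself, so serving `p` in its own queue is an emission.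
      · obtain ⟨-, s, hs, hsp, -⟩ := ruleGuard_of_ruleOf h1
        rw [hch] at hs
        cases hs
        exact hsp rfl

/-- If `p` does not emit during the `R` rounds of stabilization, its request persists and
`within_emits` applies from then on; 193 is 192 plus 1 for these rounds. -/
theorem emitsWithin_of_requests (hG : G.Connected) {R : ℕ} (hA : A.StabilizesWithin R)
    (e : Execution (ssmfp A M G.maxDegree)) {p : V} {i : ℕ} (hr : Requests e i p) :
    EmitsWithin e i (193 * max R (G.maxDegree ^ G.diam)) p := by
  classical
  obtain ⟨σ, h⟩ := settled_of_stabilizesWithin e hA i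
  have hK : R + 192 * G.maxDegree ^ G.diam ≤ 193 * max R (G.maxDegree ^ G.diam) := by omega
  have hex : ∃ j, i ≤ j ∧ j < e.rounds i (R + 192 * G.maxDegree ^ G.diam) ∧ Emits e j p := by
    by_cases hem : ∃ j, i ≤ j ∧ j < e.rounds i R ∧ Emits e j p
    · obtain ⟨j, h1, h2, h3⟩ := hem
      exact ⟨j, h1, h2.trans_le ((e.rounds_strictMono i).monotone (Nat.le_add_right _ _)), h3⟩
    have hreq : ∀ s, i ≤ s → s ≤ e.rounds i R → Requests e s p := by
      intro s hs
      induction s, hs using Nat.le_induction with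
      | base => exact fun _ => hr
      | succ s hs ih =>
        intro hs'
        have hq := ih (by omega)
        rw [Requests, req_succ hq fun hem' => hem ⟨s, hs, hs', hem'⟩]
        exact hq
    obtain ⟨s, hs, hs', j, hj, hjs, hem'⟩ :=
      h.within_emits hG (hreq _ (e.le_rounds i R) le_rfl)
    exact ⟨j, (e.le_rounds i R).trans hj, by rw [e.rounds_add]; omega, hem'⟩
  have hfind := Nat.find_spec hex
  refine ⟨Nat.find hex, _, hfind.1, hfind.2.1.trans_le ((e.rounds_strictMono i).monotone hK),
    e.afterRounds_rounds i _, hfind.2.2, fun k hk hlt hem => ?_⟩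
  exact Nat.find_min hex hlt ⟨hk, hlt.trans hfind.2.1, hem⟩

end Bounds

end SSMFP

theorem mainTheorem7 :
    ∃ C : ℕ, ∀ (V : Type u) [Fintype V] (G : SimpleGraph V) [DecidableRel G.Adj],
      G.Connected → ∀ (A : SSMFP.RoutingAlgorithm.{u, w, x} G) (R : ℕ), A.StabilizesWithin R →
      ∀ (M : Type v) (e : SSMFP.Execution (SSMFP.ssmfp A M G.maxDegree)),
        SSMFP.DelayAtMost e (C * max R (G.maxDegree ^ G.diam)) ∧
        SSMFP.WaitingTimeAtMost e (C * max R (G.maxDegree ^ G.diam)) :=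
  ⟨193, fun _ _ _ _ hG _ _ hA _ e =>
    ⟨fun _ _ hr _ => SSMFP.emitsWithin_of_requests hG hA e hr,
      fun _ _ _ _ _ _ hr => SSMFP.emitsWithin_of_requests hG hA e hr⟩⟩
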